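/- **Setting.** Let $\mathcal X$ be a real-analytic manifold of dimension $n$ and let $\mathcal D_q$ ($q\ge 1$) be the groupoid of $q$-jets $j^q\varphi|_x$ of real-analytic local diffeomorphisms $\varphi$ of $\mathcal X$, with source $\sigma(j^q\varphi|_x)=x$ and target $\tau(j^q\varphi|_x)=\varphi(x)$. Let $\mathcal G_q\subseteq\mathcal D_q$ (the $q$-th order defining equations) be a real-analytic submanifold which is a subgroupoid and is fibred over $\mathcal X$ by $\sigma$ (through each of its points there is a local analytic section of $\sigma$ with values in $\mathcal G_q$). Let $\mathcal G$ be the Lie pseudo-group of its solutions, i.e. of the real-analytic local diffeomorphisms $\varphi$ of $\mathcal X$ with $j^q\varphi|_x\in\mathcal G_q$ for all $x\in\operatorname{dom}\varphi$. Assume that $\mathcal G$ is locally transitive: each $x\in\mathcal X$ has a neighbourhood all of whose points are of the form $\varphi(x)$ with $\varphi\in\mathcal G$. Let $\mathcal G_1$ be the image of $\mathcal G_q$ in $\mathcal D_1$. Let $\mathcal U\subseteq\mathbb R^m$ be open, and let $\mathcal G$ act horizontally on the trivial bundle $\mathcal X\times\mathcal U\to\mathcal X$, that is, by $j^1\varphi|_x\cdot(x,u)=(\varphi(x),U(j^1\varphi|_x,u))$,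 where $U(g,\cdot):\mathcal U\to\mathcal U$ for $g\in\mathcal G_1$, $U(\mathbb 1_x,u)=u$, and $U(g\cdot h,u)=U(g,U(h,u))$ whenever $\sigma(g)=\tau(h)$. The components of $U$ are the lifted invariants of order zero; for $g\in\mathcal G_q$ write $U(g,u)$ for the value of $U$ at the 1-jet underlying $g$. For $X_0\in\mathcal X$ let $\mathcal G_q|^{X_0}=\{g\in\mathcal G_q:\tau(g)=X_0\}$ be the target fiber, and for a local diffeomorphism $\varphi$ and a jet $g$ with source $x\in\operatorname{dom}\varphi$ put $R_\varphi\cdot g=g\cdot j^q\varphi^{-1}|_{\varphi(x)}$. **Theorem 4.9.** Let $u:D\to\mathcal U$ and $\bar u:\bar D\to\mathcal U$ be functions on open subsets $D,\bar D\subseteq\mathcal X$. Then the following are equivalent. 1. There are $\varphi\in\mathcal G$ and a non-empty open set $W\subseteq D\cap\operatorname{dom}\varphi$ with $\varphi(W)\subseteq\bar D$ such that $\varphi$ carries the graph of $u$ over $W$ to the graph of $\bar u$: $j^1\varphi|_x\cdot(x,u(x))=(\varphi(x),\bar u(\varphi(x)))$ for all $x\in W$. 2. There are $\psi\in\mathcal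 G$, a non-empty open set $W\subseteq D\cap\operatorname{dom}\psi$ with $\psi(W)\subseteq\bar D$, a point $X_0\in\mathcal X$, and real-analytic sections $s$ over $W$ and $\bar s$ over $\psi(W)$ of $\mathcal G_q|^{X_0}\xrightarrow{\sigma}\mathcal X$, related by the right action, $R_\psi\cdot s(x)=\bar s(\psi(x))$ for all $x\in W$, such that $U(s(x),u(x))=U(\bar s(\psi(x)),\bar u(\psi(x)))$ for all $x\in W$. Moreover the equivalence holds for each transformation separately: for $\varphi\in\mathcal G$ and $x_0\in\mathcal X$, there is an open $W\ni x_0$ for which (1) holds with this $\varphi$ if and only if there is an open $W\ni x_0$ for which (2) holds with $\psi=\varphi$. -/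

import Mathlib

open Set Filter Topology
open scoped Manifold ContDiff

noncomputable section

/-- Local diffeomorphisms of the real-analytic `n`-manifold `X`: real-analytic bijections between
open subsets of `X` with real-analytic inverse. -/
abbrev LocalDiffeo (n : ℕ) (X : Type*) [TopologicalSpace X]
    [ChartedSpace (EuclideanSpace ℝ (Fin n)) X] : Type _ :=
  PartialDiffeomorph (𝓡 n) (𝓡 n) X X ω

/-- The identity transformation of `X`. -/
def LocalDiffeo.id (n : ℕ) (X : Type*) [TopologicalSpace X]
    [ChartedSpace (EuclideanSpace ℝ (Fin n)) X] : LocalDiffeo n X :=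
  (Diffeomorph.refl (𝓡 n) X ω).toPartialDiffeomorph

section Jets

variable {n : ℕ} {X : Type*} [TopologicalSpace X] [ChartedSpace (EuclideanSpace ℝ (Fin n)) X]

variable (n X) in
/-- A local diffeomorphism together with a point of its domain. -/
structure PointedDiffeo where
  map : LocalDiffeo n X
  pt : X
  mem : pt ∈ map.source

/-- Two local diffeomorphisms have the same `q`-jet at a point: same point, same value, and, in
all charts around the point and its image, the same partial derivatives of order at most `q`. -/
def jetSetoid (n q : ℕ) (X : Type*) [TopologicalSpace X]
    [ChartedSpace (EuclideanSpace ℝ (Fin n)) X] : Setoid (PointedDiffeo n X) where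
  r a b := a.pt = b.pt ∧ a.map a.pt = b.map b.pt ∧
    ∀ c ∈ atlas (EuclideanSpace ℝ (Fin n)) X, ∀ d ∈ atlas (EuclideanSpace ℝ (Fin n)) X,
      a.pt ∈ c.source → a.map a.pt ∈ d.source → ∀ k ≤ q,
        iteratedFDeriv ℝ k (d ∘ a.map ∘ c.symm) (c a.pt) =
          iteratedFDeriv ℝ k (d ∘ b.map ∘ c.symm) (c b.pt)
  iseqv :=
    { refl := fun _ => ⟨rfl, rfl, fun _ _ _ _ _ _ _ _ => rfl⟩
      symm := fun ⟨h₁, h₂, h₃⟩ => ⟨h₁.symm, h₂.symm, fun c hc d hd ha hb k hk =>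
        (h₃ c hc d hd (h₁ ▸ ha) (h₂ ▸ hb) k hk).symm⟩
      trans := fun ⟨h₁, h₂, h₃⟩ ⟨k₁, k₂, k₃⟩ => ⟨h₁.trans k₁, h₂.trans k₂,
        fun c hc d hd ha hb k hk => (h₃ c hc d hd ha hb k hk).trans
          (k₃ c hc d hd (h₁ ▸ ha) (h₂ ▸ hb) k hk)⟩ }

/-- The set `𝒟_q(X)` of `q`-jets of local diffeomorphisms of `X`. -/
def Jet (n q : ℕ) (X : Type*) [TopologicalSpace X]
    [ChartedSpace (EuclideanSpace ℝ (Fin n)) X] : Type _ :=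
  Quotient (jetSetoid n q X)

/-- The `q`-jet `j^q φ|_x`. -/
def jet (q : ℕ) (φ : LocalDiffeo n X) (x : X) (hx : x ∈ φ.source) : Jet n q X :=
  Quotient.mk (jetSetoid n q X) ⟨φ, x, hx⟩

/-- The space of jet coordinates `(x, X^i_K)_{|K| ≤ q}` (source point and derivatives of order
`0, …, q`; the derivative of order `0` is the target point). -/
abbrev JetCoord (n q : ℕ) : Type :=
  EuclideanSpace ℝ (Fin n) ×
    ((k : Fin (q + 1)) →
      ContinuousMultilinearMap ℝ (fun _ : Fin (k : ℕ) => EuclideanSpace ℝ (Fin n))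
        (EuclideanSpace ℝ (Fin n)))

namespace Jet

variable {q : ℕ}

/-- The source `σ(j^q φ|_x) = x`. -/
def src (g : Jet n q X) : X :=
  Quotient.lift (s := jetSetoid n q X) (fun a => a.pt) (fun _ _ h => h.1) g

/-- The target `τ(j^q φ|_x) = φ(x)`. -/
def tgt (g : Jet n q X) : X :=
  Quotient.lift (s := jetSetoid n q X) (fun a => a.map a.pt) (fun _ _ h => h.2.1) g

open Classical in
/-- The jet coordinates of a jet with respect to the preferred charts around `x` (for the source)
and around `y` (for the target); the value is `0` if the jet does not lie over these charts. -/
def coords (x y : X) (g : Jet n q X) : JetCoord n q :=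
  Quotient.lift (s := jetSetoid n q X)
    (fun a =>
      if a.pt ∈ (chartAt (EuclideanSpace ℝ (Fin n)) x).source ∧
          a.map a.pt ∈ (chartAt (EuclideanSpace ℝ (Fin n)) y).source then
        (chartAt (EuclideanSpace ℝ (Fin n)) x a.pt, fun k =>
          iteratedFDeriv ℝ (k : ℕ)
            (chartAt (EuclideanSpace ℝ (Fin n)) y ∘ a.map ∘
              (chartAt (EuclideanSpace ℝ (Fin n)) x).symm)
            (chartAt (EuclideanSpace ℝ (Fin n)) x a.pt))
      else 0)
    (by
      intro a b h
      by_cases hc : a.pt ∈ (chartAt (EuclideanSpace ℝ (Fin n)) x).source ∧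
          a.map a.pt ∈ (chartAt (EuclideanSpace ℝ (Fin n)) y).source
      · have hc' : b.pt ∈ (chartAt (EuclideanSpace ℝ (Fin n)) x).source ∧
            b.map b.pt ∈ (chartAt (EuclideanSpace ℝ (Fin n)) y).source := by
          rw [← h.2.1, ← h.1]
          exact hc
        simp only [if_pos hc, if_pos hc']
        refine Prod.ext (by simp only [h.1]) (funext fun k => ?_)
        exact h.2.2 _ (chart_mem_atlas _ x) _ (chart_mem_atlas _ y) hc.1 hc.2 k
          (Nat.lt_succ_iff.mp k.2)
      · have hc' : ¬ (b.pt ∈ (chartAt (EuclideanSpace ℝ (Fin n)) x).source ∧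
            b.map b.pt ∈ (chartAt (EuclideanSpace ℝ (Fin n)) y).source) := by
          rw [← h.2.1, ← h.1]
          exact hc
        simp only [if_neg hc, if_neg hc'])
    g

/-- The projection `𝒟_q(X) → 𝒟_p(X)` for `p ≤ q`. -/
def trunc {p : ℕ} (h : p ≤ q) (g : Jet n q X) : Jet n p X :=
  Quotient.map' (s₁ := jetSetoid n q X) (s₂ := jetSetoid n p X) (fun a => a)
    (fun _ _ H => ⟨H.1, H.2.1, fun c hc d hd ha hb k hk =>
      H.2.2 c hc d hd ha hb k (hk.trans h)⟩) g

/-- A representative of a jet. -/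
def rep (g : Jet n q X) : PointedDiffeo n X := Quotient.out (s := jetSetoid n q X) g

theorem jet_rep (g : Jet n q X) : jet q g.rep.map g.rep.pt g.rep.mem = g :=
  Quotient.out_eq (s := jetSetoid n q X) g

theorem src_eq (g : Jet n q X) : g.src = g.rep.pt := by
  conv_lhs => rw [← g.jet_rep]
  rfl

theorem tgt_eq (g : Jet n q X) : g.tgt = g.rep.map g.rep.pt := by
  conv_lhs => rw [← g.jet_rep]
  rfl

/-- The groupoid product `g · h`, defined when the source of `g` is the target of `h`: it is the
jet of the composition of representatives (see `Jet.mul_jet` for the independence of these). -/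
def mul (g h : Jet n q X) (H : g.src = h.tgt) : Jet n q X :=
  jet q (h.rep.map.trans g.rep.map) h.rep.pt
    ⟨h.rep.mem, by
      change h.rep.map h.rep.pt ∈ g.rep.map.source
      rw [← h.tgt_eq, ← H, g.src_eq]
      exact g.rep.mem⟩

/-- The groupoid inverse: the jet of the inverse of a representative at the target (see
`Jet.inv_jet` for the independence of the representative). -/
def inv (g : Jet n q X) : Jet n q X :=
  jet q g.rep.map.symm (g.rep.map g.rep.pt) (g.rep.map.map_source g.rep.mem)

/-- The unit `𝟙(x)`, the jet of the identity at `x`. -/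
def one (n q : ℕ) {X : Type*} [TopologicalSpace X]
    [ChartedSpace (EuclideanSpace ℝ (Fin n)) X] (x : X) : Jet n q X :=
  jet q (LocalDiffeo.id n X) x (mem_univ x)

end Jet

/-- In analytic charts a local diffeomorphism is analytic. -/
theorem LocalDiffeo.contDiffAt_charts [IsManifold (𝓡 n) ω X] (φ : LocalDiffeo n X) {x : X}
    (hx : x ∈ φ.source) {c d : OpenPartialHomeomorph X (EuclideanSpace ℝ (Fin n))}
    (hc : c ∈ atlas (EuclideanSpace ℝ (Fin n)) X) (hd : d ∈ atlas (EuclideanSpace ℝ (Fin n)) X)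
    (hxc : x ∈ c.source) (hxd : φ x ∈ d.source) :
    ContDiffAt ℝ ω (d ∘ φ ∘ c.symm) (c x) := by
  have h1 : ContMDiffAt (𝓡 n) (𝓡 n) ω φ x :=
    (φ.contMDiffOn_toFun x hx).contMDiffAt (φ.open_source.mem_nhds hx)
  have h2 : ContMDiffAt (𝓡 n) (𝓡 n) ω c.symm (c x) :=
    (contMDiffOn_symm_of_mem_maximalAtlas (I := 𝓡 n) (n := ω)
      (IsManifold.subset_maximalAtlas (I := 𝓡 n) (n := ω) hc) (c x)
      (c.map_source hxc)).contMDiffAt (c.open_target.mem_nhds (c.map_source hxc))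
  have h3 : ContMDiffAt (𝓡 n) (𝓡 n) ω d (φ x) :=
    contMDiffAt_of_mem_maximalAtlas (I := 𝓡 n) (n := ω)
      (IsManifold.subset_maximalAtlas (I := 𝓡 n) (n := ω) hd) hxd
  have e : c.symm (c x) = x := c.left_inv hxc
  have h5 : ContMDiffAt (𝓡 n) (𝓡 n) ω (φ ∘ c.symm) (c x) :=
    ContMDiffAt.comp (I' := 𝓡 n) (c x) (e.symm ▸ h1) h2
  have h4 : ContMDiffAt (𝓡 n) (𝓡 n) ω (d ∘ (φ ∘ c.symm)) (c x) := by
    refine ContMDiffAt.comp (I' := 𝓡 n) (c x) ?_ h5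
    change ContMDiffAt (𝓡 n) (𝓡 n) ω d (φ (c.symm (c x)))
    rw [e]
    exact h3
  exact h4.contDiffAt

/-- The chain rule: the jet of a composition depends only on the jets of the two factors. -/
theorem jet_trans_congr [IsManifold (𝓡 n) ω X] {q : ℕ} {φ φ' ψ ψ' : LocalDiffeo n X} {x x' y y' : X}
    (hx : x ∈ φ.source) (hx' : x' ∈ φ'.source) (hy : y ∈ ψ.source) (hy' : y' ∈ ψ'.source)
    (e : φ x = y) (e' : φ' x' = y')
    (h₁ : jet q φ x hx = jet q φ' x' hx') (h₂ : jet q ψ y hy = jet q ψ' y' hy') :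
    jet q (φ.trans ψ) x ⟨hx, show φ x ∈ ψ.source from e ▸ hy⟩ =
      jet q (φ'.trans ψ') x' ⟨hx', show φ' x' ∈ ψ'.source from e' ▸ hy'⟩ := by
  subst e e'
  obtain ⟨a₁, a₂, a₃⟩ := Quotient.exact (s := jetSetoid n q X) h₁
  obtain ⟨b₁, b₂, b₃⟩ := Quotient.exact (s := jetSetoid n q X) h₂
  dsimp only at a₁ a₂ a₃ b₁ b₂ b₃
  subst a₁
  refine Quotient.sound (s := jetSetoid n q X) ⟨rfl, b₂, ?_⟩
  intro c hc d hd hxc hxd k hk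
  change ψ (φ x) ∈ d.source at hxd
  change x ∈ c.source at hxc
  set f := chartAt (EuclideanSpace ℝ (Fin n)) (φ x) with hf
  have hfa : f ∈ atlas (EuclideanSpace ℝ (Fin n)) X := chart_mem_atlas _ _
  have hfs : φ x ∈ f.source := mem_chart_source _ _
  have key : ∀ (α β : LocalDiffeo n X) (hα : x ∈ α.source), α x ∈ f.source →
      α x ∈ β.source → β (α x) ∈ d.source →
      iteratedFDeriv ℝ k (d ∘ (α.trans β) ∘ c.symm) (c x) =
        (ftaylorSeries ℝ (d ∘ β ∘ f.symm) (f (α x))).taylorComp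
          (ftaylorSeries ℝ (f ∘ α ∘ c.symm) (c x)) k := by
    intro α β hα hαf hαβ hβd
    have ec : c.symm (c x) = x := c.left_inv hxc
    have hcont : ContinuousAt (α ∘ c.symm) (c x) := by
      refine ContinuousAt.comp ?_ (c.continuousAt_symm (c.map_source hxc))
      rw [ec]
      exact ((α.contMDiffOn_toFun x hα).continuousWithinAt).continuousAt
        (α.open_source.mem_nhds hα)
    have hev : (d ∘ (α.trans β) ∘ c.symm) =ᶠ[𝓝 (c x)]
        (d ∘ β ∘ f.symm) ∘ (f ∘ α ∘ c.symm) := by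
      have : ∀ᶠ z in 𝓝 (c x), (α ∘ c.symm) z ∈ f.source := by
        apply hcont.eventually_mem
        apply f.open_source.mem_nhds
        simpa [ec] using hαf
      filter_upwards [this] with z hz
      change d (β (α (c.symm z))) = d (β (f.symm (f (α (c.symm z)))))
      exact congrArg (fun t => d (β t)) (f.left_inv hz).symm
    rw [(hev.iteratedFDeriv ℝ k).eq_of_nhds]
    have ev : (f ∘ α ∘ c.symm) (c x) = f (α x) := by simp [ec]
    rw [iteratedFDeriv_comp (n := ω) (by
      rw [ev]; exact LocalDiffeo.contDiffAt_charts β hαβ hfa hd hαf hβd)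
      (LocalDiffeo.contDiffAt_charts α hα hc hfa hxc hαf) (by simp), ev]
  change iteratedFDeriv ℝ k (d ∘ (φ.trans ψ) ∘ c.symm) (c x) =
    iteratedFDeriv ℝ k (d ∘ (φ'.trans ψ') ∘ c.symm) (c x)
  rw [key φ ψ hx hfs hy hxd, key φ' ψ' hx' (a₂ ▸ hfs) hy' (b₂ ▸ hxd)]
  have hA : ∀ i ≤ k, ftaylorSeries ℝ (f ∘ φ ∘ c.symm) (c x) i =
      ftaylorSeries ℝ (f ∘ φ' ∘ c.symm) (c x) i :=
    fun i hi => a₃ c hc f hfa hxc hfs i (hi.trans hk)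
  have hB : ∀ i ≤ k, ftaylorSeries ℝ (d ∘ ψ ∘ f.symm) (f (φ x)) i =
      ftaylorSeries ℝ (d ∘ ψ' ∘ f.symm) (f (φ' x)) i :=
    fun i hi => b₃ f hfa d hd hfs hxd i (hi.trans hk)
  simp only [FormalMultilinearSeries.taylorComp]
  refine Finset.sum_congr rfl fun P _ => ?_
  simp only [FormalMultilinearSeries.compAlongOrderedFinpartition]
  rw [hB _ P.length_le]
  congr 1
  funext i
  exact hA _ (P.partSize_le i)

/-- The product of the jets of `ψ` and `φ` is the jet of `ψ ∘ φ`. -/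
theorem Jet.mul_jet [IsManifold (𝓡 n) ω X] {q : ℕ} {φ ψ : LocalDiffeo n X} {x : X}
    (hx : x ∈ φ.source) (hy : φ x ∈ ψ.source) :
    (jet q ψ (φ x) hy).mul (jet q φ x hx) rfl = jet q (φ.trans ψ) x ⟨hx, hy⟩ := by
  refine jet_trans_congr _ hx _ hy ?_ rfl (Jet.jet_rep _) (Jet.jet_rep _)
  rw [← Jet.tgt_eq, ← Jet.src_eq]
  rfl

/-- Transformations which agree near a point have the same jet there. -/
theorem jet_congr {q : ℕ} {φ ψ : LocalDiffeo n X} {x : X}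
    (hx : x ∈ φ.source) (hy : x ∈ ψ.source) (h : φ =ᶠ[𝓝 x] ψ) : jet q φ x hx = jet q ψ x hy := by
  refine Quotient.sound (s := jetSetoid n q X) ⟨rfl, h.eq_of_nhds, ?_⟩
  intro c _ d _ hxc _ k _
  refine (Filter.EventuallyEq.iteratedFDeriv ℝ ?_ k).eq_of_nhds
  have hc : Tendsto c.symm (𝓝 (c x)) (𝓝 x) := c.tendsto_symm hxc
  filter_upwards [hc.eventually h] with z hz
  change d (φ (c.symm z)) = d (ψ (c.symm z))
  rw [hz]

/-- The inverse of the jet of `φ` at `x` is the jet of the inverse of `φ` at `φ(x)`. -/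
theorem Jet.inv_jet [IsManifold (𝓡 n) ω X] {q : ℕ} {φ : LocalDiffeo n X} {x : X}
    (hx : x ∈ φ.source) :
    (jet q φ x hx).inv = jet q φ.symm (φ x) (φ.map_source hx) := by
  have main : ∀ (α β : LocalDiffeo n X) (hα : x ∈ α.source) (hβ : x ∈ β.source),
      jet q α x hα = jet q β x hβ →
        jet q α.symm (α x) (α.map_source hα) = jet q β.symm (β x) (β.map_source hβ) := by
    intro α β hα hβ h
    have e : α x = β x := (Quotient.exact (s := jetSetoid n q X) h).2.1
    have lα : α.symm (α x) = x := α.left_inv hα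
    have lβ : β.symm (β x) = x := β.left_inv hβ
    have hβ' : β x ∈ β.symm.source := β.map_source hβ
    have hα' : β x ∈ α.symm.source := e ▸ α.map_source hα
    have h1 := jet_trans_congr (q := q) (φ := β.symm) (φ' := β.symm) (x := β x) (x' := β x)
      (y := x) (y' := x) hβ' hβ' hβ hα lβ lβ rfl h.symm
    have m1 : β x ∈ (β.symm.trans β).source := ⟨hβ', Eq.mpr (congrArg (· ∈ β.source) lβ) hβ⟩
    have m2 : β x ∈ (β.symm.trans α).source := ⟨hβ', Eq.mpr (congrArg (· ∈ α.source) lβ) hα⟩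
    have t1 : (β.symm.trans β) (β x) = β x := congrArg β lβ
    have t2 : (β.symm.trans α) (β x) = β x := (congrArg α lβ).trans e
    have h2 := jet_trans_congr (q := q) m1 m2 hα' hα' t1 t2 h1 rfl
    refine ((?_ : _ = jet q α.symm (β x) hα').trans ?_).trans (h2.trans ?_)
    · congr 1
    · refine jet_congr _ _ ?_
      filter_upwards [β.open_target.mem_nhds hβ'] with z hz
      exact (congrArg α.symm (β.right_inv hz)).symm
    · refine jet_congr _ _ ?_
      have hc : ContinuousAt β.symm (β x) :=
        (β.symm.contMDiffOn_toFun _ hβ').continuousWithinAt.continuousAt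
          (β.symm.open_source.mem_nhds hβ')
      have : ∀ᶠ z in 𝓝 (β x), β.symm z ∈ α.source :=
        hc.eventually_mem (α.open_source.mem_nhds (lβ.symm ▸ hα))
      filter_upwards [this] with z hz
      exact α.left_inv hz
  have aux : ∀ r : PointedDiffeo n X, r.pt = x → jet q r.map r.pt r.mem = jet q φ x hx →
      jet q r.map.symm (r.map r.pt) (r.map.map_source r.mem) =
        jet q φ.symm (φ x) (φ.map_source hx) := by
    rintro ⟨α, y, hy⟩ rfl hr
    exact main α φ hy hx hr
  exact aux _ (Jet.src_eq _).symm (Jet.jet_rep _)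

/-- A local real-analytic section over the open set `W`, with values in the set of jets `S`, of
the source map `σ`: in jet coordinates it is a real-analytic map. -/
structure IsAnalyticSection {q : ℕ} (S : Set (Jet n q X)) (W : Set X) (s : X → Jet n q X) :
    Prop where
  isOpen : IsOpen W
  mem : ∀ x ∈ W, s x ∈ S
  src_eq : ∀ x ∈ W, (s x).src = x
  tgt_mem : ∀ x ∈ W, ∀ᶠ y in 𝓝 x,
    (s y).tgt ∈ (chartAt (EuclideanSpace ℝ (Fin n)) (s x).tgt).source
  analyticAt : ∀ x ∈ W, AnalyticAt ℝ
    (fun z => (s ((chartAt (EuclideanSpace ℝ (Fin n)) x).symm z)).coords x (s x).tgt)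
    (chartAt (EuclideanSpace ℝ (Fin n)) x x)

/-- A set of jets is an (embedded) real-analytic submanifold of `𝒟_q(X)`: in every coordinate chart
and around each of its points there, a real-analytic change of coordinates carries it to a linear
subspace. (The coordinates of jets of local diffeomorphisms are, locally, the points of the linear
subspace given by the symmetry of the higher derivatives, so this is the usual notion of a
submanifold for subsets of `𝒟_q(X)`.) -/
def IsAnalyticJetSubmanifold {q : ℕ} (S : Set (Jet n q X)) : Prop :=
  ∀ g ∈ S, ∀ x y : X, g.src ∈ (chartAt (EuclideanSpace ℝ (Fin n)) x).source →
    g.tgt ∈ (chartAt (EuclideanSpace ℝ (Fin n)) y).source →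
    ∃ (Φ : OpenPartialHomeomorph (JetCoord n q) (JetCoord n q))
      (L : Submodule ℝ (JetCoord n q)),
      g.coords x y ∈ Φ.source ∧
      AnalyticOnNhd ℝ Φ Φ.source ∧ AnalyticOnNhd ℝ Φ.symm Φ.target ∧
      ∀ v ∈ Φ.source, Φ v ∈ L ↔
        ∃ h ∈ S, h.src ∈ (chartAt (EuclideanSpace ℝ (Fin n)) x).source ∧
          h.tgt ∈ (chartAt (EuclideanSpace ℝ (Fin n)) y).source ∧ h.coords x y = v

end Jets

/-- A Lie pseudo-group of order `q`, given by its defining equations `𝒢_q ⊆ 𝒟_q(X)`: a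
real-analytic submanifold, fibred over `X` by the source map (through each of its points there is
a local analytic section), and a subgroupoid of `𝒟_q(X)`. The transformations of the pseudo-group
are the local solutions, see `LiePseudogroup.Mem`. -/
structure LiePseudogroup (n q : ℕ) (X : Type*) [TopologicalSpace X]
    [ChartedSpace (EuclideanSpace ℝ (Fin n)) X] where
  /-- the defining equations `𝒢_q`, as a subset of the jet space -/
  eqns : Set (Jet n q X)
  submanifold : IsAnalyticJetSubmanifold eqns
  fibred : ∀ g ∈ eqns, ∃ (W : Set X) (s : X → Jet n q X),
    IsAnalyticSection eqns W s ∧ g.src ∈ W ∧ s g.src = g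
  one_mem : ∀ x : X, Jet.one n q x ∈ eqns
  mul_mem : ∀ g ∈ eqns, ∀ h ∈ eqns, ∀ H : g.src = h.tgt, g.mul h H ∈ eqns
  inv_mem : ∀ g ∈ eqns, g.inv ∈ eqns

namespace LiePseudogroup

variable {n q : ℕ} {X : Type*} [TopologicalSpace X] [ChartedSpace (EuclideanSpace ℝ (Fin n)) X]

/-- The local diffeomorphism `φ` belongs to the pseudo-group: it solves the defining equations. -/
def Mem (G : LiePseudogroup n q X) (φ : LocalDiffeo n X) : Prop :=
  ∀ (x : X) (hx : x ∈ φ.source), jet q φ x hx ∈ G.eqns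

/-- The pseudo-group is (locally) transitive: the transformations in `𝒢` defined at a point `x`
carry `x` to all points of some neighbourhood of `x`, that is, the orbits of `𝒢` are open. -/
def IsLocallyTransitive (G : LiePseudogroup n q X) : Prop :=
  ∀ x : X, ∀ᶠ y in 𝓝 x, ∃ φ : LocalDiffeo n X, G.Mem φ ∧ x ∈ φ.source ∧ φ x = y

/-- The target fiber `𝒢_q|^{X₀} = τ⁻¹(X₀)`. -/
def targetFiber (G : LiePseudogroup n q X) (X₀ : X) : Set (Jet n q X) :=
  {g | g ∈ G.eqns ∧ g.tgt = X₀}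

/-- The groupoid `𝒢_p`, `p ≤ q`, of truncated jets. -/
def lower (G : LiePseudogroup n q X) {p : ℕ} (hp : p ≤ q) : Set (Jet n p X) :=
  Jet.trunc hp '' G.eqns

end LiePseudogroup

section Action

variable {n q : ℕ} {X : Type*} [TopologicalSpace X] [ChartedSpace (EuclideanSpace ℝ (Fin n)) X]

/-- The right action `R_φ · g = g · j^q φ⁻¹|_{φ(x)}` of a local diffeomorphism on a jet `g` whose
source `x` is in the domain of `φ`. -/
def rightAct (φ : LocalDiffeo n X) (g : Jet n q X) (hg : g.src ∈ φ.source) : Jet n q X :=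
  g.mul (jet q φ.symm (φ g.src) (φ.map_source hg)) (φ.left_inv hg).symm

/-- A horizontal action of the pseudo-group on the trivial bundle `X × 𝒰 → X`: an action of the
form `j¹φ|_x · (x, u) = (φ(x), U(x, u, j¹φ|_x))`. The source point `x` is part of the jet, so `U`
is a function of the jet and `u`; its components are the lifted invariants of order zero. The laws
say that this is an action of the groupoid `𝒢_1`. No regularity of `U` is required. -/
structure HorizontalAction {m : ℕ} (G : LiePseudogroup n q X) (hq : 1 ≤ q)
    (𝒰 : Set (EuclideanSpace ℝ (Fin m))) where
  U : Jet n 1 X → EuclideanSpace ℝ (Fin m) → EuclideanSpace ℝ (Fin m)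
  mapsTo : ∀ g ∈ G.lower hq, MapsTo (U g) 𝒰 𝒰
  one_act : ∀ (x : X), ∀ u ∈ 𝒰, U (Jet.one n 1 x) u = u
  mul_act : ∀ g ∈ G.lower hq, ∀ h ∈ G.lower hq, ∀ H : g.src = h.tgt, ∀ u ∈ 𝒰,
    U (g.mul h H) u = U g (U h u)

namespace HorizontalAction

variable {m : ℕ} {G : LiePseudogroup n q X} {hq : 1 ≤ q} {𝒰 : Set (EuclideanSpace ℝ (Fin m))}

/-- Over the set `W`, the transformation `φ` carries the graph of the local function `u` (defined
on `D`) to the graph of the local function `u'` (defined on `D'`): for `x ∈ W`,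
`j¹φ|_x · (x, u(x)) = (φ(x), u'(φ(x)))`. -/
def Carries (A : HorizontalAction G hq 𝒰) (φ : LocalDiffeo n X) (W D D' : Set X)
    (u u' : X → EuclideanSpace ℝ (Fin m)) : Prop :=
  W ⊆ D ∧ MapsTo φ W D' ∧
    ∀ x ∈ W, ∃ hx : x ∈ φ.source, A.U (jet 1 φ x hx) (u x) = u' (φ x)

/-- There are a target point `X₀` and analytic sections `s` over `W` and `s'` over `φ(W)` of the
target fiber over `X₀`, related by the right action of `φ`, along which the lifted invariants of
order zero of `u` and `u'` agree. -/
def SectionsAgree (A : HorizontalAction G hq 𝒰) (φ : LocalDiffeo n X) (W D D' : Set X)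
    (u u' : X → EuclideanSpace ℝ (Fin m)) : Prop :=
  W ⊆ D ∧ MapsTo φ W D' ∧ W ⊆ φ.source ∧
    ∃ (X₀ : X) (s s' : X → Jet n q X),
      IsAnalyticSection (G.targetFiber X₀) W s ∧
      IsAnalyticSection (G.targetFiber X₀) (φ '' W) s' ∧
      (∀ x ∈ W, ∃ hx : (s x).src ∈ φ.source, rightAct φ (s x) hx = s' (φ x)) ∧
      ∀ x ∈ W, A.U ((s x).trunc hq) (u x) = A.U ((s' (φ x)).trunc hq) (u' (φ x))

end HorizontalAction

end Action

end

/-! The equivalence rests on the invariance identity U(R_φ·g, j¹φ·u) = U(g, u), which is the action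
law applied to the factorization g = (R_φ·g)·jφ (`act_rightAct`). If s̄ is the right translate of a
section s, the equality of the lifted invariants along s and s̄ therefore says that U(s̄(φ(x)), ·)
takes the same value at j¹φ|_x·u(x) and at ū(φ(x)). Since jets are invertible, U(g, ·) is injective
on 𝒰 (`injOn`), so this amounts to φ carrying one graph to the other.

What remains is to produce, near a given point, an analytic section of some target fiber
(`exists_isAnalyticSection_targetFiber`); local transitivity enters only there. It suffices to find
a jet over the point at which (σ, τ) is a submersion on 𝒢_q. Transitivity gives only surjectivity of
(σ, τ) onto pairs of nearby points, so a dimension argument is needed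
(`exists_analytic_section_of_transitive`). Let d(g) be the rank of τ along the σ-fiber through g.
Right multiplication by elements of 𝒢_q permutes the σ-fibers and preserves τ, hence d(g) depends
only on τ(g). Choose a target y₁ at which d is maximal; by semicontinuity of the rank, d is constant
for targets in a neighbourhood N₁ of y₁, so (σ, τ) has constant rank n + d over N₁. If d < n, the
constant rank theorem and a countable cover bound the Hausdorff dimension of the image by n + d <
2n, although the image contains a non-empty open set. Hence d = n, (σ, τ) is a submersion over N₁,
and a local right inverse restricted to pairs (z, y₁) is the section. -/

noncomputable section

/-! ### Inverse functions and submersions in the analytic category. -/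

section Calculus

variable {V W : Type*} [NormedAddCommGroup V] [NormedSpace ℝ V]
  [NormedAddCommGroup W] [NormedSpace ℝ W]

/-- The inverse function theorem for analytic maps. -/
theorem AnalyticAt.exists_local_inverse [CompleteSpace V] {f : V → W} {v₀ : V} (hf : AnalyticAt ℝ f v₀)
    (e : V ≃L[ℝ] W) (he : HasFDerivAt f (e : V →L[ℝ] W) v₀) :
    ∃ g : W → V, AnalyticAt ℝ g (f v₀) ∧ (∀ᶠ v in 𝓝 v₀, g (f v) = v) ∧
      (∀ᶠ w in 𝓝 (f v₀), f (g w) = w) ∧ HasFDerivAt g (e.symm : W →L[ℝ] V) (f v₀) := by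
  have hs : HasStrictFDerivAt f (e : V →L[ℝ] W) v₀ := by
    have := hf.hasStrictFDerivAt
    rwa [he.fderiv] at this
  refine ⟨hs.localInverse f e v₀, ?_, hs.eventually_left_inverse, hs.eventually_right_inverse,
    hs.to_localInverse.hasFDerivAt⟩
  exact (hs.toOpenPartialHomeomorph f).analyticAt_symm' (i := e)
    hs.mem_toOpenPartialHomeomorph_source hf he.fderiv

/-- A local analytic right inverse of a submersion, with prescribed derivative. -/
theorem AnalyticAt.exists_right_inverse [CompleteSpace W] {f : V → W} {v₀ : V}
    (hf : AnalyticAt ℝ f v₀)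
    (R : W →L[ℝ] V) (hR : ∀ w, fderiv ℝ f v₀ (R w) = w) :
    ∃ r : W → V, AnalyticAt ℝ r (f v₀) ∧ r (f v₀) = v₀ ∧ (∀ᶠ w in 𝓝 (f v₀), f (r w) = w) ∧
      HasFDerivAt r R (f v₀) := by
  -- Restricting `f` to the affine slice through `v₀` in the directions of `R` makes its derivative
  -- the identity; inverting there and returning along the slice gives a right inverse with
  -- derivative `R`.
  set a : W → V := fun w => v₀ + R w with ha
  have ha0 : a 0 = v₀ := by simp [ha]
  have haA : AnalyticAt ℝ a 0 := analyticAt_const.add (R.analyticAt 0)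
  have hfa : AnalyticAt ℝ (f ∘ a) 0 := AnalyticAt.comp (by rwa [ha0]) haA
  have haD : HasFDerivAt a R 0 := R.hasFDerivAt.const_add v₀
  have hd : HasFDerivAt (f ∘ a) (ContinuousLinearEquiv.refl ℝ W : W →L[ℝ] W) 0 := by
    have h1 : HasFDerivAt f (fderiv ℝ f v₀) (a 0) := by
      rw [ha0]; exact hf.differentiableAt.hasFDerivAt
    convert h1.comp 0 haD using 1
    ext w
    simp [hR]
  obtain ⟨k, hk, hl, hr, hkd⟩ := hfa.exists_local_inverse _ hd
  have e0 : (f ∘ a) 0 = f v₀ := by simp [ha0]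
  rw [e0] at hk hr hkd
  have k0 : k (f v₀) = 0 := by
    have := hl.self_of_nhds
    rwa [e0] at this
  refine ⟨a ∘ k, ?_, by simp [k0, ha0], hr, ?_⟩
  · exact AnalyticAt.comp (by rwa [k0]) hk
  · have : HasFDerivAt a R (k (f v₀)) := by rwa [k0]
    exact this.comp _ hkd

/-- A vector in the kernel of the derivative of a submersion is the velocity of a curve in the
level set. -/
theorem AnalyticAt.exists_curve_of_fderiv_eq_zero [CompleteSpace W] {f : V → W} {v₀ : V}
    (hf : AnalyticAt ℝ f v₀)
    (R : W →L[ℝ] V) (hR : ∀ w, fderiv ℝ f v₀ (R w) = w) {v : V} (hv : fderiv ℝ f v₀ v = 0) :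
    ∃ c : ℝ → V, HasDerivAt c v 0 ∧ c 0 = v₀ ∧ ∀ᶠ t in 𝓝 0, f (c t) = f v₀ := by
  set a : ℝ × V → V := fun p => p.2 + p.1 • v with ha
  have haA : AnalyticAt ℝ a (0, v₀) :=
    analyticAt_snd.add (analyticAt_fst.smul analyticAt_const)
  have ha0 : a (0, v₀) = v₀ := by simp [ha]
  -- As `v` lies in the kernel, the derivative of `F` at `(0, v₀)` is `(t, w) ↦ (t, f' w)`, with
  -- right inverse `(t, w) ↦ (t, R w)`. The right inverse of `F` along `(t, f v₀)` thus has no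
  -- velocity in `V`, and adding `t • v` gives a curve with velocity exactly `v`.
  set F : ℝ × V → ℝ × W := fun p => (p.1, f (a p)) with hF
  have hfa : AnalyticAt ℝ (fun p => f (a p)) (0, v₀) :=
    AnalyticAt.comp (g := f) (by rwa [ha0]) haA
  have hFA : AnalyticAt ℝ F (0, v₀) := analyticAt_fst.prod hfa
  have haD : HasFDerivAt a (ContinuousLinearMap.snd ℝ ℝ V +
      (ContinuousLinearMap.fst ℝ ℝ V).smulRight v) (0, v₀) :=
    hasFDerivAt_snd.add (hasFDerivAt_fst.smul_const v)
  have hD : HasFDerivAt F ((ContinuousLinearMap.fst ℝ ℝ V).prod ((fderiv ℝ f v₀).comp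
      (ContinuousLinearMap.snd ℝ ℝ V + (ContinuousLinearMap.fst ℝ ℝ V).smulRight v)))
      (0, v₀) := by
    have h1 : HasFDerivAt f (fderiv ℝ f v₀) (a (0, v₀)) := by
      rw [ha0]; exact hf.differentiableAt.hasFDerivAt
    exact hasFDerivAt_fst.prodMk (h1.comp (0, v₀) haD)
  obtain ⟨r, hr, hr0, hrr, hrD⟩ := hFA.exists_right_inverse
    ((ContinuousLinearMap.fst ℝ ℝ W).prod (R.comp (ContinuousLinearMap.snd ℝ ℝ W))) (by
      rintro ⟨t, w⟩
      rw [hD.fderiv]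
      simp [hR, hv])
  have F0 : F (0, v₀) = (0, f v₀) := by simp [hF, ha0]
  rw [F0] at hr hr0 hrr hrD
  have hline : HasDerivAt (fun t : ℝ => (t, f v₀)) ((1 : ℝ), (0 : W)) 0 :=
    (hasDerivAt_id 0).prodMk (hasDerivAt_const 0 (f v₀))
  have hrc := HasFDerivAt.comp_hasDerivAt (0 : ℝ) (f := fun t : ℝ => (t, f v₀)) hrD hline
  refine ⟨fun t => (r (t, f v₀)).2 + t • v, ?_, by simp [hr0], ?_⟩
  · have h2 := (hasFDerivAt_snd (𝕜 := ℝ) (p := r (0, f v₀))).comp_hasDerivAt (0 : ℝ) hrc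
    have h3 := h2.add ((hasDerivAt_id (0 : ℝ)).smul_const v)
    have h4 : HasDerivAt (fun t => (r (t, f v₀)).2 + t • v) _ 0 := h3
    simpa using h4
  · have hc : Tendsto (fun t : ℝ => (t, f v₀)) (𝓝 0) (𝓝 (0, f v₀)) := hline.continuousAt
    filter_upwards [hc.eventually hrr] with t ht
    have h1 := congrArg Prod.fst ht
    have h2 := congrArg Prod.snd ht
    simp only [hF, ha] at h1 h2
    rw [h1] at h2
    exact h2

end Calculus

/-! ### Maps of constant rank and the dimension of their images. -/

section ConstantRank

variable {V W : Type*} [NormedAddCommGroup V] [NormedSpace ℝ V] [FiniteDimensional ℝ V]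
  [NormedAddCommGroup W] [NormedSpace ℝ W] [FiniteDimensional ℝ W]

open Module in
/-- The image of a map of constant rank `r` has, locally, Hausdorff dimension at most `r`. -/
theorem AnalyticAt.exists_dimH_image_le_of_finrank_eq {f : V → W} {v₀ : V}
    (hf : AnalyticAt ℝ f v₀)
    (hr : ∀ᶠ v in 𝓝 v₀, finrank ℝ (fderiv ℝ f v).range = finrank ℝ (fderiv ℝ f v₀).range) :
    ∃ U ∈ 𝓝 v₀, dimH (f '' U) ≤ finrank ℝ (fderiv ℝ f v₀).range := by
  have := FiniteDimensional.complete ℝ V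
  have := FiniteDimensional.complete ℝ W
  set M := fderiv ℝ f v₀ with hM
  set S : Submodule ℝ W := M.range with hS
  set N : Submodule ℝ V := M.ker with hN
  obtain ⟨p₀, hp₀⟩ := S.subtype.exists_leftInverse_of_injective S.ker_subtype
  obtain ⟨π₀, hπ₀⟩ := N.subtype.exists_leftInverse_of_injective N.ker_subtype
  set p : W →L[ℝ] S := p₀.toContinuousLinearMap with hp
  set π : V →L[ℝ] N := π₀.toContinuousLinearMap with hπ
  have pS : ∀ s : S, p s = s := fun s => LinearMap.congr_fun hp₀ s
  have πN : ∀ s : N, π s = s := fun s => LinearMap.congr_fun hπ₀ s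
  -- Straightening coordinates: projections onto the range and the kernel of the derivative at `v₀`.
  -- The aim is that `f` no longer depends on the kernel coordinate.
  set g : V → S × N := fun v => (p (f v), π v) with hg
  have hgA : AnalyticAt ℝ g v₀ :=
    ((p.analyticAt _).comp hf).prod (π.analyticAt _)
  have hgD : ∀ v, AnalyticAt ℝ f v → HasFDerivAt g ((p.comp (fderiv ℝ f v)).prod π) v := by
    intro v hv
    exact (p.hasFDerivAt.comp v hv.differentiableAt.hasFDerivAt).prodMk π.hasFDerivAt
  set T : V →L[ℝ] S × N := (p.comp M).prod π with hT
  have hTi : Function.Injective T := by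
    refine (injective_iff_map_eq_zero T).2 fun v hv => ?_
    have h1 : p (M v) = 0 := congrArg Prod.fst hv
    have h2 : π v = 0 := congrArg Prod.snd hv
    have h3 : M v = 0 := by
      have := pS ⟨M v, LinearMap.mem_range_self _ v⟩
      rw [h1] at this
      exact (congrArg Subtype.val this).symm
    have := πN ⟨v, h3⟩
    rw [h2] at this
    exact (congrArg Subtype.val this).symm
  have hdim : finrank ℝ V = finrank ℝ (S × N) := by
    rw [finrank_prod]
    exact (LinearMap.finrank_range_add_finrank_ker (M : V →ₗ[ℝ] W)).symm
  set e : V ≃L[ℝ] S × N :=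
    (LinearEquiv.ofInjectiveOfFinrankEq (T : V →ₗ[ℝ] S × N) hTi hdim).toContinuousLinearEquiv
  have he : (e : V →L[ℝ] S × N) = T := by
    ext v <;> rfl
  obtain ⟨Ψ, hΨ, hl, hrr, -⟩ := hgA.exists_local_inverse e (by rw [he]; exact hgD v₀ hf)
  have hΨ0 : Ψ (g v₀) = v₀ := hl.self_of_nhds
  have hcΨ : Tendsto Ψ (𝓝 (g v₀)) (𝓝 v₀) := by
    simpa [ContinuousAt, hΨ0] using hΨ.continuousAt
  set F : S × N → W := fun w => f (Ψ w) with hFdef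
  have ev : ∀ᶠ w in 𝓝 (g v₀), AnalyticAt ℝ F w ∧ ∀ b : N, fderiv ℝ F w (0, b) = 0 := by
    filter_upwards [hΨ.eventually_analyticAt, hcΨ.eventually hf.eventually_analyticAt,
      hcΨ.eventually hr, hrr.eventually_nhds] with w hw1 hw2 hw3 hw4
    have hFw : AnalyticAt ℝ F w := AnalyticAt.comp (g := f) hw2 hw1
    refine ⟨hFw, fun b => ?_⟩
    set D := fderiv ℝ f (Ψ w) with hD
    set Q := fderiv ℝ Ψ w with hQ
    have hFD : fderiv ℝ F w = D.comp Q :=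
      (hw2.differentiableAt.hasFDerivAt.comp w hw1.differentiableAt.hasFDerivAt).fderiv
    have hid : ((p.comp D).prod π).comp Q = ContinuousLinearMap.id ℝ (S × N) := by
      have h1 := ((hgD _ hw2).comp w hw1.differentiableAt.hasFDerivAt)
      have h2 : HasFDerivAt (g ∘ Ψ) (ContinuousLinearMap.id ℝ (S × N)) w :=
        (hasFDerivAt_id w).congr_of_eventuallyEq (hw4.mono fun z hz => hz)
      exact h1.unique h2
    have hp1 : ∀ a b, p (D (Q (a, b))) = a := fun a b =>
      congrArg Prod.fst (DFunLike.congr_fun hid (a, b))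
    -- The projection is onto from the nearby range to `S`; since the ranks agree it is also
    -- injective. The derivative in a kernel direction is projected to zero, so it vanishes.
    set P : D.range →ₗ[ℝ] S := (p : W →ₗ[ℝ] S).comp (Submodule.subtype _) with hP
    have hPs : Function.Surjective P := fun a =>
      ⟨⟨D (Q (a, 0)), LinearMap.mem_range_self _ _⟩, hp1 a 0⟩
    have hPi : Function.Injective P :=
      (LinearMap.injective_iff_surjective_of_finrank_eq_finrank hw3).2 hPs
    have h0 : (⟨D (Q (0, b)), LinearMap.mem_range_self _ _⟩ : D.range) = 0 := by
      apply hPi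
      rw [map_zero]
      exact hp1 0 b
    rw [hFD]
    exact congrArg Subtype.val h0
  obtain ⟨ε, hε, hball⟩ := Metric.eventually_nhds_iff_ball.1 ev
  set a₀ := (g v₀).1
  set b₀ := (g v₀).2
  have hmem : ∀ a ∈ Metric.ball a₀ ε, ∀ b ∈ Metric.ball b₀ ε, (a, b) ∈ Metric.ball (g v₀) ε := by
    intro a ha b hb
    rw [← ball_prod_same (g v₀).1 (g v₀).2 ε]
    exact ⟨ha, hb⟩
  have hconst : ∀ a ∈ Metric.ball a₀ ε, ∀ b ∈ Metric.ball b₀ ε, F (a, b) = F (a, b₀) := by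
    intro a ha b hb
    have hder : ∀ b' ∈ Metric.ball b₀ ε,
        HasFDerivWithinAt (fun b' => F (a, b')) (0 : N →L[ℝ] W) (Metric.ball b₀ ε) b' := by
      intro b' hb'
      obtain ⟨h1, h2⟩ := hball _ (hmem a ha b' hb')
      have h3 := h1.differentiableAt.hasFDerivAt.comp b' (hasFDerivAt_prodMk_right a b')
      have h4 : (fderiv ℝ F (a, b')).comp (ContinuousLinearMap.inr ℝ S N) = 0 := by
        ext c
        exact h2 c
      rw [h4] at h3
      exact h3.hasFDerivWithinAt
    exact (convex_ball b₀ ε).is_const_of_fderivWithin_eq_zero (𝕜 := ℝ)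
      (fun b' hb' => (hder b' hb').differentiableWithinAt)
      (fun b' hb' => (hder b' hb').fderivWithin
        (Metric.isOpen_ball.uniqueDiffWithinAt hb')) hb (Metric.mem_ball_self hε)
  refine ⟨{v | Ψ (g v) = v ∧ g v ∈ Metric.ball (g v₀) ε},
    hl.and (hgA.continuousAt.eventually_mem (Metric.ball_mem_nhds _ hε)), ?_⟩
  -- The image is swept out by the slice at `b₀`, a smooth image of a ball in `S`, whose dimension
  -- is the rank.
  have hsub : f '' {v | Ψ (g v) = v ∧ g v ∈ Metric.ball (g v₀) ε} ⊆
      (fun a => F (a, b₀)) '' Metric.ball a₀ ε := by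
    rintro _ ⟨v, ⟨h1, h2⟩, rfl⟩
    rw [← ball_prod_same (g v₀).1 (g v₀).2 ε] at h2
    refine ⟨(g v).1, h2.1, ?_⟩
    change F ((g v).1, b₀) = f v
    rw [← hconst _ h2.1 _ h2.2]
    exact congrArg f h1
  have hcd : ContDiffOn ℝ 1 (fun a => F (a, b₀)) (Metric.ball a₀ ε) := by
    intro a ha
    have h1 := (hball _ (hmem a ha b₀ (Metric.mem_ball_self hε))).1
    have h2 : AnalyticAt ℝ (fun a => F (a, b₀)) a :=
      AnalyticAt.comp (g := F) h1 (analyticAt_id.prod analyticAt_const)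
    exact h2.contDiffAt.contDiffWithinAt
  calc dimH (f '' _) ≤ dimH ((fun a => F (a, b₀)) '' Metric.ball a₀ ε) := dimH_mono hsub
    _ ≤ dimH (Metric.ball a₀ ε) := hcd.dimH_image_le (convex_ball _ _) Subset.rfl
    _ ≤ dimH (univ : Set S) := dimH_mono (subset_univ _)
    _ = finrank ℝ S := Real.dimH_univ_eq_finrank S

/-- Lower semicontinuity of the rank of the derivative. -/
theorem AnalyticAt.eventually_finrank_range_fderiv_le {f : V → W} {v₀ : V}
    (hf : AnalyticAt ℝ f v₀) :
    ∀ᶠ v in 𝓝 v₀,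
      Module.finrank ℝ (fderiv ℝ f v₀).range ≤ Module.finrank ℝ (fderiv ℝ f v).range := by
  have := FiniteDimensional.complete ℝ W
  have key : ∀ (k : ℕ) (T : V →L[ℝ] W),
      (k : Cardinal) ≤ (T : V →ₗ[ℝ] W).rank ↔ k ≤ Module.finrank ℝ T.range := by
    intro k T
    rw [LinearMap.rank, ← Module.finrank_eq_rank, Nat.cast_le]
  have hc : ContinuousAt (fderiv ℝ f) v₀ := hf.fderiv.continuousAt
  have := hc.eventually_mem ((isOpen_setOfPred_nat_le_rank (𝕜 := ℝ) (E := V) (F := W)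
    (Module.finrank ℝ (fderiv ℝ f v₀).range)).mem_nhds ((key _ _).2 le_rfl))
  filter_upwards [this] with v hv
  exact (key _ _).1 hv

end ConstantRank

/-! ### Groupoid laws for jets. -/

section JetAlgebra

variable {n q : ℕ} {X : Type*} [TopologicalSpace X] [ChartedSpace (EuclideanSpace ℝ (Fin n)) X]

namespace Jet

theorem exists_jet (g : Jet n q X) :
    ∃ (φ : LocalDiffeo n X) (x : X) (hx : x ∈ φ.source), g = jet q φ x hx :=
  ⟨_, _, _, g.jet_rep.symm⟩

/-- Reduces groupoid identities to compositions of maps: the base point of the second representative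
is literally the image of the first, which is the form that `mul_jet` requires. -/
theorem exists_jet_jet {g h : Jet n q X} (H : g.src = h.tgt) :
    ∃ (φ ψ : LocalDiffeo n X) (x : X) (hx : x ∈ φ.source) (hy : φ x ∈ ψ.source),
      h = jet q φ x hx ∧ g = jet q ψ (φ x) hy := by
  obtain ⟨φ, x, hx, rfl⟩ := h.exists_jet
  obtain ⟨ψ, y, hy, rfl⟩ := g.exists_jet
  obtain rfl : y = φ x := H
  exact ⟨φ, ψ, x, hx, hy, rfl, rfl⟩

@[simp] theorem src_trunc {p : ℕ} (h : p ≤ q) (g : Jet n q X) : (g.trunc h).src = g.src := by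
  obtain ⟨φ, x, hx, rfl⟩ := g.exists_jet
  rfl

@[simp] theorem tgt_trunc {p : ℕ} (h : p ≤ q) (g : Jet n q X) : (g.trunc h).tgt = g.tgt := by
  obtain ⟨φ, x, hx, rfl⟩ := g.exists_jet
  rfl

variable [IsManifold (𝓡 n) ω X]

@[simp] theorem src_mul (g h : Jet n q X) (H : g.src = h.tgt) : (g.mul h H).src = h.src := by
  obtain ⟨φ, ψ, x, hx, hy, rfl, rfl⟩ := exists_jet_jet H
  rw [mul_jet]
  rfl

@[simp] theorem tgt_mul (g h : Jet n q X) (H : g.src = h.tgt) : (g.mul h H).tgt = g.tgt := by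
  obtain ⟨φ, ψ, x, hx, hy, rfl, rfl⟩ := exists_jet_jet H
  rw [mul_jet]
  rfl

@[simp] theorem src_inv (g : Jet n q X) : g.inv.src = g.tgt := by
  obtain ⟨φ, x, hx, rfl⟩ := g.exists_jet
  rw [inv_jet]
  rfl

@[simp] theorem tgt_inv (g : Jet n q X) : g.inv.tgt = g.src := by
  obtain ⟨φ, x, hx, rfl⟩ := g.exists_jet
  rw [inv_jet]
  exact φ.left_inv hx

theorem mul_one' (g : Jet n q X) : g.mul (one n q g.src) rfl = g := by
  obtain ⟨φ, x, hx, rfl⟩ := g.exists_jet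
  exact (mul_jet (φ := LocalDiffeo.id n X) (ψ := φ) (mem_univ x) hx).trans
    (jet_congr _ _ (Eventually.of_forall fun _ => rfl))

theorem one_mul' (g : Jet n q X) : (one n q g.tgt).mul g rfl = g := by
  obtain ⟨φ, x, hx, rfl⟩ := g.exists_jet
  exact (mul_jet (φ := φ) (ψ := LocalDiffeo.id n X) hx (mem_univ (φ x))).trans
    (jet_congr _ _ (Eventually.of_forall fun _ => rfl))

theorem mul_assoc' (f g h : Jet n q X) (H₁ : f.src = g.tgt) (H₂ : g.src = h.tgt) :
    (f.mul g H₁).mul h ((src_mul _ _ _).trans H₂) =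
      f.mul (g.mul h H₂) (H₁.trans (tgt_mul _ _ _).symm) := by
  obtain ⟨φ, ψ, x, hx, hy, rfl, rfl⟩ := exists_jet_jet H₂
  obtain ⟨χ, z, hz, rfl⟩ := f.exists_jet
  obtain rfl : z = ψ (φ x) := H₁
  have h1 := mul_jet (q := q) (φ := ψ) (ψ := χ) hy hz
  have h2 := mul_jet (q := q) (φ := φ) (ψ := ψ) hx hy
  have h3 := mul_jet (q := q) (φ := φ) (ψ := ψ.trans χ) (x := x) hx ⟨hy, hz⟩
  have h4 := mul_jet (q := q) (φ := φ.trans ψ) (ψ := χ) (x := x) ⟨hx, hy⟩ hz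
  simp only [h1, h2]
  refine h3.trans (Eq.trans ?_ h4.symm)
  exact jet_congr _ _ (Eventually.of_forall fun _ => rfl)

theorem inv_mul' (g : Jet n q X) : g.inv.mul g g.src_inv = one n q g.src := by
  obtain ⟨φ, x, hx, rfl⟩ := g.exists_jet
  simp only [inv_jet]
  refine (mul_jet (φ := φ) (ψ := φ.symm) hx (φ.map_source hx)).trans (jet_congr _ _ ?_)
  filter_upwards [φ.open_source.mem_nhds hx] with z hz
  exact φ.left_inv hz

theorem mul_inv' (g : Jet n q X) : g.mul g.inv g.tgt_inv.symm = one n q g.tgt := by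
  obtain ⟨φ, x, hx, rfl⟩ := g.exists_jet
  have hs : φ x ∈ φ.symm.source := φ.map_source hx
  have e : φ.symm (φ x) = x := φ.left_inv hx
  -- The base point is freed because `φ.symm (φ x)` equals `x` only propositionally, while the jets
  -- carry it in their types' proofs of membership.
  have key : ∀ (y : X) (hy : y ∈ φ.source) (H : y = φ.symm (φ x)),
      (jet q φ y hy).mul (jet q φ.symm (φ x) hs) H = one n q (φ x) := by
    rintro _ hy rfl
    refine (mul_jet (φ := φ.symm) (ψ := φ) hs hy).trans (jet_congr _ _ ?_)
    filter_upwards [φ.open_target.mem_nhds hs] with z hz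
    exact φ.right_inv hz
  simp only [inv_jet]
  exact key x hx e.symm

theorem trunc_mul {p : ℕ} (hp : p ≤ q) (g h : Jet n q X) (H : g.src = h.tgt) :
    (g.mul h H).trunc hp = (g.trunc hp).mul (h.trunc hp) (by simpa using H) := by
  obtain ⟨φ, ψ, x, hx, hy, rfl, rfl⟩ := exists_jet_jet H
  rw [mul_jet]
  exact (mul_jet (q := p) hx hy).symm

end Jet

end JetAlgebra

/-! ### Jets in coordinates and the Faà di Bruno formula. -/

section Coordinates

variable {n q : ℕ} {X : Type*} [TopologicalSpace X] [ChartedSpace (EuclideanSpace ℝ (Fin n)) X]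

/-- The preferred chart around `x`. -/
abbrev eChart (n : ℕ) {X : Type*} [TopologicalSpace X]
    [ChartedSpace (EuclideanSpace ℝ (Fin n)) X] (x : X) :
    OpenPartialHomeomorph X (EuclideanSpace ℝ (Fin n)) :=
  chartAt (EuclideanSpace ℝ (Fin n)) x

/-- The product of jets in jet coordinates: the Faà di Bruno formula. -/
def jetCompCoord (a b : JetCoord n q) : JetCoord n q :=
  (b.1, fun k => ∑ c : OrderedFinpartition (k : ℕ), c.compAlongOrderedFinpartition
    (a.2 ⟨c.length, lt_of_le_of_lt c.length_le k.2⟩)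
    (fun m => b.2 ⟨c.partSize m, lt_of_le_of_lt (c.partSize_le m) k.2⟩))

/-- The coordinates of the target point of a jet with given coordinates. -/
def tgtCoord (n q : ℕ) : JetCoord n q →L[ℝ] EuclideanSpace ℝ (Fin n) :=
  (ContinuousMultilinearMap.apply ℝ _ _ (fun _ => 0)).comp
    ((ContinuousLinearMap.proj (⟨0, Nat.succ_pos q⟩ : Fin (q + 1))).comp
      (ContinuousLinearMap.snd ℝ _ _))

theorem tgtCoord_apply (v : JetCoord n q) :
    tgtCoord n q v = v.2 ⟨0, Nat.succ_pos q⟩ (fun _ => 0) := rfl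

theorem Jet.coords_jet {φ : LocalDiffeo n X} {x a b : X} (hx : x ∈ φ.source)
    (ha : x ∈ (eChart n a).source) (hb : φ x ∈ (eChart n b).source) :
    (jet q φ x hx).coords a b = ((eChart n a x, fun k : Fin (q + 1) =>
      iteratedFDeriv ℝ (k : ℕ) (eChart n b ∘ φ ∘ (eChart n a).symm) (eChart n a x)) : JetCoord n q) :=
  if_pos ⟨ha, hb⟩

theorem Jet.coords_fst (g : Jet n q X) {a b : X} (ha : g.src ∈ (eChart n a).source)
    (hb : g.tgt ∈ (eChart n b).source) : (g.coords a b).1 = eChart n a g.src := by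
  obtain ⟨φ, x, hx, rfl⟩ := g.exists_jet
  rw [Jet.coords_jet hx ha hb]
  rfl

theorem Jet.tgtCoord_coords (g : Jet n q X) {a b : X} (ha : g.src ∈ (eChart n a).source)
    (hb : g.tgt ∈ (eChart n b).source) : tgtCoord n q (g.coords a b) = eChart n b g.tgt := by
  obtain ⟨φ, x, hx, rfl⟩ := g.exists_jet
  rw [Jet.coords_jet hx ha hb, tgtCoord_apply]
  simp only [iteratedFDeriv_zero_apply, Function.comp_apply]
  exact congrArg (fun t => eChart n b (φ t)) ((eChart n a).left_inv ha)

theorem Jet.coords_mul [IsManifold (𝓡 n) ω X] {g h : Jet n q X} (H : g.src = h.tgt) {a b c : X}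
    (ha : h.src ∈ (eChart n a).source) (hb : h.tgt ∈ (eChart n b).source)
    (hc : g.tgt ∈ (eChart n c).source) :
    (g.mul h H).coords a c = jetCompCoord (g.coords b c) (h.coords a b) := by
  obtain ⟨φ, ψ, x, hx, hy, rfl, rfl⟩ := exists_jet_jet H
  rw [mul_jet]
  change x ∈ _ at ha
  change φ x ∈ _ at hb
  change ψ (φ x) ∈ _ at hc
  have hac : (φ.trans ψ) x ∈ (eChart n c).source := hc
  refine (coords_jet (φ := φ.trans ψ) (x := x) ⟨hx, hy⟩ ha hac).trans ?_
  rw [coords_jet hy hb hc, coords_jet hx ha hb]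
  refine Prod.ext rfl (funext fun k => ?_)
  have ec : (eChart n a).symm (eChart n a x) = x := (eChart n a).left_inv ha
  have hcont : ContinuousAt (φ ∘ (eChart n a).symm) (eChart n a x) := by
    refine ContinuousAt.comp ?_ ((eChart n a).continuousAt_symm ((eChart n a).map_source ha))
    rw [ec]
    exact ((φ.contMDiffOn_toFun x hx).continuousWithinAt).continuousAt
      (φ.open_source.mem_nhds hx)
  have hev : (eChart n c ∘ (φ.trans ψ) ∘ (eChart n a).symm) =ᶠ[𝓝 (eChart n a x)]
      (eChart n c ∘ ψ ∘ (eChart n b).symm) ∘ (eChart n b ∘ φ ∘ (eChart n a).symm) := by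
    have : ∀ᶠ z in 𝓝 (eChart n a x), (φ ∘ (eChart n a).symm) z ∈ (eChart n b).source := by
      apply hcont.eventually_mem
      apply (eChart n b).open_source.mem_nhds
      simpa [ec] using hb
    filter_upwards [this] with z hz
    exact (congrArg (fun t => eChart n c (ψ t)) ((eChart n b).left_inv hz)).symm
  have ev : (eChart n b ∘ φ ∘ (eChart n a).symm) (eChart n a x) = eChart n b (φ x) := by
    simp [ec]
  change iteratedFDeriv ℝ (k : ℕ) (eChart n c ∘ (φ.trans ψ) ∘ (eChart n a).symm) (eChart n a x) = _
  rw [(hev.iteratedFDeriv ℝ (k : ℕ)).eq_of_nhds]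
  rw [iteratedFDeriv_comp (n := ω) (by
    rw [ev]
    exact LocalDiffeo.contDiffAt_charts ψ hy (chart_mem_atlas _ b) (chart_mem_atlas _ c) hb hc)
    (LocalDiffeo.contDiffAt_charts φ hx (chart_mem_atlas _ a) (chart_mem_atlas _ b) ha hb)
    (by simp), ev]
  rfl

/-- A change of charts is multiplication on both sides by unit jets, each read in two different
charts. Coordinate changes thereby become instances of the product formula. -/
theorem Jet.coords_change [IsManifold (𝓡 n) ω X] (g : Jet n q X) {a a' b b' : X}
    (ha : g.src ∈ (eChart n a).source) (ha' : g.src ∈ (eChart n a').source)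
    (hb : g.tgt ∈ (eChart n b).source) (hb' : g.tgt ∈ (eChart n b').source) :
    g.coords a' b' = jetCompCoord ((Jet.one n q g.tgt).coords b b')
      (jetCompCoord (g.coords a b) ((Jet.one n q g.src).coords a' a)) := by
  rw [← Jet.coords_mul (g := g) (h := Jet.one n q g.src) rfl ha' ha hb, Jet.mul_one',
    ← Jet.coords_mul (g := Jet.one n q g.tgt) (h := g) rfl ha' hb hb', Jet.one_mul']

/-- Each component is a finite sum of terms multilinear in the derivatives of the two factors. -/
theorem jetCompCoord_analyticAt (p : JetCoord n q × JetCoord n q) :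
    AnalyticAt ℝ (fun p : JetCoord n q × JetCoord n q => jetCompCoord p.1 p.2) p := by
  refine AnalyticAt.prod (analyticAt_fst.comp analyticAt_snd) (AnalyticAt.pi fun k => ?_)
  refine Finset.analyticAt_fun_sum _ fun c _ => ?_
  let B := c.compAlongOrderedFinpartitionL ℝ (EuclideanSpace ℝ (Fin n))
    (EuclideanSpace ℝ (Fin n)) (EuclideanSpace ℝ (Fin n))
  let A : JetCoord n q × JetCoord n q →L[ℝ] _ :=
    ((ContinuousLinearMap.proj (⟨c.length, lt_of_le_of_lt c.length_le k.2⟩ : Fin (q + 1))).comp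
      ((ContinuousLinearMap.snd ℝ (EuclideanSpace ℝ (Fin n)) _).comp
        (ContinuousLinearMap.fst ℝ (JetCoord n q) (JetCoord n q)))).prod
    (ContinuousLinearMap.pi fun m => (ContinuousLinearMap.proj
      (⟨c.partSize m, lt_of_le_of_lt (c.partSize_le m) k.2⟩ : Fin (q + 1))).comp
      ((ContinuousLinearMap.snd ℝ (EuclideanSpace ℝ (Fin n)) _).comp
        (ContinuousLinearMap.snd ℝ (JetCoord n q) (JetCoord n q))))
  exact AnalyticAt.comp (f := A) B.analyticAt_uncurry_of_multilinear (A.analyticAt p)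

/-- In order zero there is a single ordered partition, the empty one, and its term is the value of
the outer factor. This holds for arbitrary coordinate vectors, not only those of composable jets. -/
theorem tgtCoord_jetCompCoord (a b : JetCoord n q) :
    tgtCoord n q (jetCompCoord a b) = tgtCoord n q a := by
  simp only [tgtCoord_apply, jetCompCoord]
  have : (Finset.univ : Finset (OrderedFinpartition 0)) = {default} := by
    ext c
    simp only [Finset.mem_univ, Finset.mem_singleton, true_iff]
    exact Subsingleton.elim _ _
  change (∑ c : OrderedFinpartition 0, _ : ContinuousMultilinearMap ℝ
    (fun _ : Fin 0 => EuclideanSpace ℝ (Fin n)) (EuclideanSpace ℝ (Fin n))) _ = _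
  rw [this, Finset.sum_singleton]
  change a.2 ⟨0, _⟩ _ = a.2 ⟨0, _⟩ _
  congr 1
  funext i
  exact i.elim0

end Coordinates

/-! ### Analytic families of jets and independence of charts. -/

section AnalyticFamilies

variable {n q : ℕ} {X : Type*} [TopologicalSpace X] [ChartedSpace (EuclideanSpace ℝ (Fin n)) X]
  {V V' : Type*} [NormedAddCommGroup V] [NormedSpace ℝ V] [NormedAddCommGroup V'] [NormedSpace ℝ V']

/-- A family of jets depends analytically on a parameter: it does so in jet coordinates. -/
def JetAnalyticAt (γ : V → Jet n q X) (v₀ : V) : Prop :=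
  ∃ a b : X, (∀ᶠ v in 𝓝 v₀, (γ v).src ∈ (eChart n a).source ∧ (γ v).tgt ∈ (eChart n b).source) ∧
    AnalyticAt ℝ (fun v => (γ v).coords a b) v₀

open Classical in
/-- The jet of `φ` at `x`, with the unit as a default value outside of the domain of `φ`. -/
def jetAt (q : ℕ) (φ : LocalDiffeo n X) (x : X) : Jet n q X :=
  if hx : x ∈ φ.source then jet q φ x hx else Jet.one n q x

open Classical in
/-- The product of jets, with the second factor as a default value if it is not defined. -/
def Jet.prod (g h : Jet n q X) : Jet n q X :=
  if H : g.src = h.tgt then g.mul h H else h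

theorem jetAt_of_mem {φ : LocalDiffeo n X} {x : X} (hx : x ∈ φ.source) :
    jetAt q φ x = jet q φ x hx := dif_pos hx

theorem jetAt_id (x : X) : jetAt q (LocalDiffeo.id n X) x = Jet.one n q x :=
  jetAt_of_mem (mem_univ x)

theorem Jet.prod_of_eq {g h : Jet n q X} (H : g.src = h.tgt) : g.prod h = g.mul h H := dif_pos H

theorem LocalDiffeo.continuousAt (φ : LocalDiffeo n X) {x : X} (hx : x ∈ φ.source) :
    ContinuousAt φ x :=
  (φ.contMDiffOn_toFun x hx).continuousWithinAt.continuousAt (φ.open_source.mem_nhds hx)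

namespace JetAnalyticAt

theorem congr {γ δ : V → Jet n q X} {v₀ : V} (hγ : JetAnalyticAt γ v₀) (h : γ =ᶠ[𝓝 v₀] δ) :
    JetAnalyticAt δ v₀ := by
  obtain ⟨a, b, h1, h2⟩ := hγ
  refine ⟨a, b, ?_, h2.congr ?_⟩
  · filter_upwards [h1, h] with v hv hv'
    rwa [← hv']
  · filter_upwards [h] with v hv
    rw [hv]

theorem comp {γ : V' → Jet n q X} {k : V → V'} {v₀ : V} (hγ : JetAnalyticAt γ (k v₀))
    (hk : AnalyticAt ℝ k v₀) : JetAnalyticAt (fun v => γ (k v)) v₀ := by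
  obtain ⟨a, b, h1, h2⟩ := hγ
  exact ⟨a, b, hk.continuousAt.eventually h1, AnalyticAt.comp (g := fun v => (γ v).coords a b) h2 hk⟩

end JetAnalyticAt

variable [IsManifold (𝓡 n) ω X]

theorem LocalDiffeo.analyticAt_charts (φ : LocalDiffeo n X) {a b : X}
    {z : EuclideanSpace ℝ (Fin n)} (hz : z ∈ (eChart n a).target)
    (hφ : (eChart n a).symm z ∈ φ.source) (hb : φ ((eChart n a).symm z) ∈ (eChart n b).source) :
    AnalyticAt ℝ (fun z => eChart n b (φ ((eChart n a).symm z))) z := by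
  have := LocalDiffeo.contDiffAt_charts φ hφ (chart_mem_atlas _ a) (chart_mem_atlas _ b)
    ((eChart n a).map_target hz) hb
  rw [(eChart n a).right_inv hz] at this
  exact this.analyticAt

theorem analyticAt_transition {a b : X} {z : EuclideanSpace ℝ (Fin n)}
    (hz : z ∈ (eChart n a).target) (hb : (eChart n a).symm z ∈ (eChart n b).source) :
    AnalyticAt ℝ (fun z => eChart n b ((eChart n a).symm z)) z :=
  LocalDiffeo.analyticAt_charts (LocalDiffeo.id n X) hz (mem_univ _) hb

theorem AnalyticAt.coords_jetAt {k : V → EuclideanSpace ℝ (Fin n)} {v₀ : V}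
    (hk : AnalyticAt ℝ k v₀) {a a' b : X} (hka : k v₀ ∈ (eChart n a).target)
    {φ : LocalDiffeo n X} (hφ : (eChart n a).symm (k v₀) ∈ φ.source)
    (ha' : (eChart n a).symm (k v₀) ∈ (eChart n a').source)
    (hb : φ ((eChart n a).symm (k v₀)) ∈ (eChart n b).source) :
    AnalyticAt ℝ (fun v => (jetAt q φ ((eChart n a).symm (k v))).coords a' b) v₀ := by
  have hp : ContinuousAt (fun v => (eChart n a).symm (k v)) v₀ :=
    ((eChart n a).continuousAt_symm hka).comp hk.continuousAt
  have ev : (fun v => (jetAt q φ ((eChart n a).symm (k v))).coords a' b) =ᶠ[𝓝 v₀]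
      fun v => ((eChart n a' ((eChart n a).symm (k v)), fun i : Fin (q + 1) =>
        iteratedFDeriv ℝ (i : ℕ) (eChart n b ∘ φ ∘ (eChart n a').symm)
          (eChart n a' ((eChart n a).symm (k v)))) : JetCoord n q) := by
    filter_upwards [hp.eventually_mem (φ.open_source.mem_nhds hφ),
      hp.eventually_mem ((eChart n a').open_source.mem_nhds ha'),
      (ContinuousAt.comp (g := φ) (f := fun v => (eChart n a).symm (k v))
        (φ.continuousAt hφ) hp).eventually_mem ((eChart n b).open_source.mem_nhds hb)]
      with v h1 h2 h3
    rw [jetAt_of_mem h1, Jet.coords_jet h1 h2 h3]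
  refine AnalyticAt.congr ?_ ev.symm
  have hk' : AnalyticAt ℝ (fun v => eChart n a' ((eChart n a).symm (k v))) v₀ :=
    AnalyticAt.comp (g := fun z => eChart n a' ((eChart n a).symm z))
      (analyticAt_transition hka ha') hk
  refine hk'.prod (AnalyticAt.pi fun i => ?_)
  have hF : AnalyticAt ℝ (eChart n b ∘ φ ∘ (eChart n a').symm)
      (eChart n a' ((eChart n a).symm (k v₀))) :=
    (LocalDiffeo.contDiffAt_charts φ hφ (chart_mem_atlas _ a') (chart_mem_atlas _ b)
      ha' hb).analyticAt
  obtain ⟨s, hs, hsF⟩ := hF.exists_mem_nhds_analyticOnNhd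
  exact AnalyticAt.comp (g := iteratedFDeriv ℝ (i : ℕ) (eChart n b ∘ φ ∘ (eChart n a').symm))
    ((hsF.iteratedFDeriv (i : ℕ)) _ (mem_of_mem_nhds hs)) hk'

theorem AnalyticAt.jetAnalyticAt_jetAt {k : V → EuclideanSpace ℝ (Fin n)} {v₀ : V}
    (hk : AnalyticAt ℝ k v₀) {a : X} (hka : k v₀ ∈ (eChart n a).target)
    {φ : LocalDiffeo n X} (hφ : (eChart n a).symm (k v₀) ∈ φ.source) :
    JetAnalyticAt (fun v => jetAt q φ ((eChart n a).symm (k v))) v₀ := by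
  have hp : ContinuousAt (fun v => (eChart n a).symm (k v)) v₀ :=
    ((eChart n a).continuousAt_symm hka).comp hk.continuousAt
  refine ⟨_, _, ?_, hk.coords_jetAt hka hφ (mem_chart_source _ _) (mem_chart_source _ _)⟩
  filter_upwards [hp.eventually_mem (φ.open_source.mem_nhds hφ),
      hp.eventually_mem ((eChart n _).open_source.mem_nhds (mem_chart_source _ _)),
      (ContinuousAt.comp (g := φ) (f := fun v => (eChart n a).symm (k v))
        (φ.continuousAt hφ) hp).eventually_mem
        ((eChart n _).open_source.mem_nhds (mem_chart_source _ _))]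
      with v h1 h2 h3
  rw [jetAt_of_mem h1]
  exact ⟨h2, h3⟩

namespace JetAnalyticAt

/-- Analyticity of a family of jets can be tested in any jet coordinates. -/
theorem coords {γ : V → Jet n q X} {v₀ : V} (h : JetAnalyticAt γ v₀) {a b : X}
    (ha : (γ v₀).src ∈ (eChart n a).source) (hb : (γ v₀).tgt ∈ (eChart n b).source) :
    (∀ᶠ v in 𝓝 v₀, (γ v).src ∈ (eChart n a).source ∧ (γ v).tgt ∈ (eChart n b).source) ∧
      AnalyticAt ℝ (fun v => (γ v).coords a b) v₀ := by
  obtain ⟨c, d, hcd, hA⟩ := h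
  obtain ⟨hc, hd⟩ := hcd.self_of_nhds
  -- Source and target can be recovered from the old coordinates, hence vary continuously and stay
  -- in the new charts. The unit jets at these moving points are analytic families too, so
  -- `Jet.coords_change` applies.
  have hsA : AnalyticAt ℝ (fun v => ((γ v).coords c d).1) v₀ := analyticAt_fst.comp hA
  have htA : AnalyticAt ℝ (fun v => tgtCoord n q ((γ v).coords c d)) v₀ :=
    ((tgtCoord n q).analyticAt _).comp hA
  have es : ∀ᶠ v in 𝓝 v₀, (eChart n c).symm ((γ v).coords c d).1 = (γ v).src := by
    filter_upwards [hcd] with v hv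
    rw [Jet.coords_fst _ hv.1 hv.2, (eChart n c).left_inv hv.1]
  have et : ∀ᶠ v in 𝓝 v₀, (eChart n d).symm (tgtCoord n q ((γ v).coords c d)) = (γ v).tgt := by
    filter_upwards [hcd] with v hv
    rw [Jet.tgtCoord_coords _ hv.1 hv.2, (eChart n d).left_inv hv.2]
  have hs0 : ((γ v₀).coords c d).1 ∈ (eChart n c).target := by
    rw [Jet.coords_fst _ hc hd]; exact (eChart n c).map_source hc
  have ht0 : tgtCoord n q ((γ v₀).coords c d) ∈ (eChart n d).target := by
    rw [Jet.tgtCoord_coords _ hc hd]; exact (eChart n d).map_source hd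
  have hs1 := es.self_of_nhds
  have ht1 := et.self_of_nhds
  have cs : ContinuousAt (fun v => (γ v).src) v₀ :=
    (ContinuousAt.comp (f := fun v => ((γ v).coords c d).1)
      ((eChart n c).continuousAt_symm hs0) hsA.continuousAt).congr es
  have ct : ContinuousAt (fun v => (γ v).tgt) v₀ :=
    (ContinuousAt.comp (f := fun v => tgtCoord n q ((γ v).coords c d))
      ((eChart n d).continuousAt_symm ht0) htA.continuousAt).congr et
  have ev : ∀ᶠ v in 𝓝 v₀, (γ v).src ∈ (eChart n a).source ∧ (γ v).tgt ∈ (eChart n b).source :=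
    (cs.eventually_mem ((eChart n a).open_source.mem_nhds ha)).and
      (ct.eventually_mem ((eChart n b).open_source.mem_nhds hb))
  refine ⟨ev, ?_⟩
  have h1 : AnalyticAt ℝ (fun v => (Jet.one n q (γ v).src).coords a c) v₀ := by
    refine (hsA.coords_jetAt (q := q) (a' := a) (b := c) (φ := LocalDiffeo.id n X) hs0 (mem_univ _)
      (by rwa [hs1]) (by rw [hs1]; exact hc)).congr ?_
    filter_upwards [es] with v hv
    rw [hv, jetAt_id]
  have h2 : AnalyticAt ℝ (fun v => (Jet.one n q (γ v).tgt).coords d b) v₀ := by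
    refine (htA.coords_jetAt (q := q) (a' := d) (b := b) (φ := LocalDiffeo.id n X) ht0 (mem_univ _)
      (by rwa [ht1]) (by rw [ht1]; exact hb)).congr ?_
    filter_upwards [et] with v hv
    rw [hv, jetAt_id]
  have h3 := (jetCompCoord_analyticAt (n := n) (q := q) _).comp (hA.prod h1)
  have h4 := (jetCompCoord_analyticAt (n := n) (q := q) _).comp (h2.prod h3)
  refine h4.congr ?_
  filter_upwards [hcd, ev] with v hv hv'
  exact (Jet.coords_change (γ v) hv.1 hv'.1 hv.2 hv'.2).symm

theorem prod {γ δ : V → Jet n q X} {v₀ : V} (hγ : JetAnalyticAt γ v₀) (hδ : JetAnalyticAt δ v₀)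
    (H : ∀ᶠ v in 𝓝 v₀, (γ v).src = (δ v).tgt) : JetAnalyticAt (fun v => (γ v).prod (δ v)) v₀ := by
  set a := (δ v₀).src
  set b := (δ v₀).tgt with hb
  set c := (γ v₀).tgt
  obtain ⟨h1, h2⟩ := hδ.coords (a := a) (b := b) (mem_chart_source _ _) (mem_chart_source _ _)
  obtain ⟨h3, h4⟩ := hγ.coords (a := b) (b := c)
    (by rw [H.self_of_nhds]; exact mem_chart_source _ _) (mem_chart_source _ _)
  refine ⟨a, c, ?_, ?_⟩
  · filter_upwards [h1, h3, H] with v hv1 hv3 hv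
    rw [Jet.prod_of_eq hv, Jet.src_mul, Jet.tgt_mul]
    exact ⟨hv1.1, hv3.2⟩
  · refine ((jetCompCoord_analyticAt (n := n) (q := q) _).comp (h4.prod h2)).congr ?_
    filter_upwards [h1, h3, H] with v hv1 hv3 hv
    rw [Jet.prod_of_eq hv]
    exact (Jet.coords_mul hv hv1.1 hv1.2 hv3.2).symm

/-- Analyticity of a field of jets on `X` can be tested in any chart of `X`. -/
theorem change_chart {s : X → Jet n q X} {x a b : X} (ha : x ∈ (eChart n a).source)
    (hb : x ∈ (eChart n b).source)
    (h : JetAnalyticAt (fun z => s ((eChart n a).symm z)) (eChart n a x)) :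
    JetAnalyticAt (fun z => s ((eChart n b).symm z)) (eChart n b x) := by
  have hbt := (eChart n b).map_source hb
  have hx : (eChart n b).symm (eChart n b x) = x := (eChart n b).left_inv hb
  have hA : AnalyticAt ℝ (fun z => eChart n a ((eChart n b).symm z)) (eChart n b x) :=
    analyticAt_transition hbt (by rwa [hx])
  refine (comp (γ := fun z => s ((eChart n a).symm z))
    (k := fun z => eChart n a ((eChart n b).symm z)) (by rwa [hx]) hA).congr ?_
  have : ContinuousAt (eChart n b).symm (eChart n b x) := (eChart n b).continuousAt_symm hbt
  filter_upwards [this.eventually_mem ((eChart n a).open_source.mem_nhds (by rwa [hx]))] with z hz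
  exact congrArg s ((eChart n a).left_inv hz)

end JetAnalyticAt

theorem IsAnalyticSection.jetAnalyticAt {S : Set (Jet n q X)} {W : Set X} {s : X → Jet n q X}
    (h : IsAnalyticSection S W s) {x a : X} (hx : x ∈ W) (ha : x ∈ (eChart n a).source) :
    JetAnalyticAt (fun z => s ((eChart n a).symm z)) (eChart n a x) := by
  refine JetAnalyticAt.change_chart (mem_chart_source _ x) ha
    ⟨x, (s x).tgt, ?_, h.analyticAt x hx⟩
  have hc : Tendsto (eChart n x).symm (𝓝 (eChart n x x)) (𝓝 x) :=
    (eChart n x).tendsto_symm (mem_chart_source _ x)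
  filter_upwards [hc.eventually (h.tgt_mem x hx), hc.eventually (h.isOpen.mem_nhds hx),
    hc.eventually ((eChart n x).open_source.mem_nhds (mem_chart_source _ x))] with z h1 h2 h3
  rw [h.src_eq _ h2]
  exact ⟨h3, h1⟩

/-- Any one chart around the point is enough, in place of its preferred chart; the condition on
targets follows from the continuity built into analytic families. -/
theorem IsAnalyticSection.of_jetAnalyticAt {S : Set (Jet n q X)} {W : Set X} {s : X → Jet n q X}
    (hW : IsOpen W) (hS : ∀ x ∈ W, s x ∈ S) (hsrc : ∀ x ∈ W, (s x).src = x)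
    (h : ∀ x ∈ W, ∃ a, x ∈ (eChart n a).source ∧
      JetAnalyticAt (fun z => s ((eChart n a).symm z)) (eChart n a x)) :
    IsAnalyticSection S W s := by
  have key : ∀ x ∈ W, _ ∧ _ := fun x hx => by
    obtain ⟨a, ha, hA⟩ := h x hx
    have hb : (eChart n x).symm (eChart n x x) = x :=
      (eChart n x).left_inv (mem_chart_source _ x)
    exact (hA.change_chart ha (mem_chart_source _ x)).coords (a := x) (b := (s x).tgt)
      (by simp only [hb, hsrc x hx]; exact mem_chart_source _ x)
      (by simp only [hb]; exact mem_chart_source _ _)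
  refine ⟨hW, hS, hsrc, fun x hx => ?_, fun x hx => (key x hx).2⟩
  have hc : Tendsto (eChart n x) (𝓝 x) (𝓝 (eChart n x x)) :=
    (eChart n x).continuousAt (mem_chart_source _ x)
  filter_upwards [hc.eventually (key x hx).1,
    (eChart n x).open_source.mem_nhds (mem_chart_source _ x)] with y h1 h2
  have := h1.2
  rwa [(eChart n x).left_inv h2] at this

end AnalyticFamilies

/-! ### From surjectivity of source and target to a submersion. -/

section Transitivity

open Module

/-- Rank–nullity for `A`, for `(A, B)`, and for `B` restricted to the kernel of `A`; the last two
have kernels of the same dimension. -/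
theorem LinearMap.finrank_range_prod_of_surjective {M E F : Type*} [AddCommGroup M] [Module ℝ M]
    [FiniteDimensional ℝ M] [AddCommGroup E] [Module ℝ E] [AddCommGroup F] [Module ℝ F]
    (A : M →ₗ[ℝ] E) (B : M →ₗ[ℝ] F) (hA : Function.Surjective A) :
    finrank ℝ (A.prod B).range = finrank ℝ E + finrank ℝ (A.ker.map B) := by
  have h1 := (A.prod B).finrank_range_add_finrank_ker
  have h2 := A.finrank_range_add_finrank_ker
  have h3 := (B.domRestrict A.ker).finrank_range_add_finrank_ker
  rw [LinearMap.range_eq_top.2 hA, finrank_top] at h2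
  rw [LinearMap.range_domRestrict, LinearMap.ker_domRestrict] at h3
  rw [LinearMap.ker_prod, ← Submodule.map_comap_subtype, Submodule.finrank_map_subtype_eq] at h1
  omega

variable {E J M : Type*} [NormedAddCommGroup E] [NormedSpace ℝ E]
  [NormedAddCommGroup J] [NormedSpace ℝ J] [NormedAddCommGroup M] [NormedSpace ℝ M]

/-- `P` is an analytic parametrization of the set `K` near `P l`, with inverse the restriction of
the analytic map `Q`. -/
structure IsLocalParam (K : Set J) (P : M → J) (Q : J → M) (l : M) : Prop where
  analyticAt : AnalyticAt ℝ P l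
  mem : ∀ᶠ l' in 𝓝 l, P l' ∈ K
  analyticAt_inv : AnalyticAt ℝ Q (P l)
  left_inv : ∀ᶠ l' in 𝓝 l, Q (P l') = l'
  right_inv : ∀ᶠ v in 𝓝 (P l), v ∈ K → P (Q v) = v

/-- All five conditions are open, so one parametrization serves to compute ranks at all nearby
points. -/
theorem IsLocalParam.eventually [CompleteSpace M] [CompleteSpace J] {K : Set J} {P : M → J}
    {Q : J → M} {l : M} (h : IsLocalParam K P Q l) : ∀ᶠ l' in 𝓝 l, IsLocalParam K P Q l' := by
  have hc : Tendsto P (𝓝 l) (𝓝 (P l)) := h.analyticAt.continuousAt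
  filter_upwards [h.analyticAt.eventually_analyticAt, h.mem.eventually_nhds,
    hc.eventually h.analyticAt_inv.eventually_analyticAt, h.left_inv.eventually_nhds,
    hc.eventually h.right_inv.eventually_nhds] with l' h1 h2 h3 h4 h5
  exact ⟨h1, h2, h3, h4, h5⟩

/-- A linear projection onto `L` after the straightening map extends the inverse parametrization
analytically off `K`. -/
theorem IsLocalParam.of_chart [FiniteDimensional ℝ J] {K : Set J} {v : J} (hv : v ∈ K)
    (Φ : OpenPartialHomeomorph J J) (L : Submodule ℝ J) (hvΦ : v ∈ Φ.source)
    (hΦ : AnalyticOnNhd ℝ Φ Φ.source) (hΦ' : AnalyticOnNhd ℝ Φ.symm Φ.target)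
    (hL : ∀ w ∈ Φ.source, Φ w ∈ L ↔ w ∈ K) :
    ∃ (P : L → J) (Q : J → L) (l : L), IsLocalParam K P Q l ∧ P l = v := by
  obtain ⟨p₀, hp₀⟩ := L.subtype.exists_leftInverse_of_injective L.ker_subtype
  set p : J →L[ℝ] L := p₀.toContinuousLinearMap with hp
  have pL : ∀ s : L, p s = s := fun s => LinearMap.congr_fun hp₀ s
  have hvt : Φ v ∈ Φ.target := Φ.map_source hvΦ
  have hev : ∀ᶠ l : L in 𝓝 ⟨Φ v, (hL v hvΦ).2 hv⟩, (l : J) ∈ Φ.target :=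
    ContinuousAt.eventually_mem (f := ((↑) : L → J)) continuous_subtype_val.continuousAt
      (Φ.open_target.mem_nhds hvt)
  have hPv : Φ.symm (Φ v) = v := Φ.left_inv hvΦ
  refine ⟨fun l => Φ.symm l, fun w => p (Φ w), ⟨Φ v, (hL v hvΦ).2 hv⟩,
    ⟨?_, ?_, ?_, ?_, ?_⟩, hPv⟩
  · exact AnalyticAt.comp (g := Φ.symm) (hΦ' _ hvt) (L.subtypeL.analyticAt _)
  · filter_upwards [hev] with l hl
    rw [← hL _ (Φ.map_target hl), Φ.right_inv hl]
    exact l.2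
  · change AnalyticAt ℝ (fun w => p (Φ w)) (Φ.symm (Φ v))
    rw [hPv]
    exact (p.analyticAt _).comp (hΦ v hvΦ)
  · filter_upwards [hev] with l hl
    rw [Φ.right_inv hl, pL]
  · change ∀ᶠ w in 𝓝 (Φ.symm (Φ v)), _
    rw [hPv]
    filter_upwards [Φ.open_source.mem_nhds hvΦ] with w hw hwK
    have := pL ⟨Φ w, (hL w hw).2 hwK⟩
    rw [this]
    exact Φ.left_inv hw

/-- The velocities, measured by `τ`, of curves in `K` through `v` along which `σ` is constant. -/
def fiberVelocities (K : Set J) (σ τ : J →L[ℝ] E) (v : J) : Set E :=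
  {w | ∃ (c : ℝ → J) (c' : J), HasDerivAt c c' 0 ∧ c 0 = v ∧
    (∀ᶠ t in 𝓝 0, c t ∈ K ∧ σ (c t) = σ v) ∧ τ c' = w}

/-- Curves are pushed forward by `T`. Describing velocities by curves makes this work with no
tangent spaces: `T` need only be differentiable at `v` and respect `K` on one fiber of `σ`. -/
theorem fiberVelocities_subset {K : Set J} {σ τ : J →L[ℝ] E} {v w : J} {T : J → J}
    (hT : DifferentiableAt ℝ T v) (hTv : T v = w)
    (hTK : ∀ u ∈ K, σ u = σ v → T u ∈ K ∧ σ (T u) = σ w ∧ τ (T u) = τ u) :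
    fiberVelocities K σ τ v ⊆ fiberVelocities K σ τ w := by
  rintro _ ⟨c, c', hc, h0, hev, rfl⟩
  have hTc : HasDerivAt (fun t => T (c t)) (fderiv ℝ T v c') 0 :=
    HasFDerivAt.comp_hasDerivAt (0 : ℝ) (l := T) (f := c) (by rw [h0]; exact hT.hasFDerivAt) hc
  refine ⟨fun t => T (c t), _, hTc, by simp [h0, hTv], ?_, ?_⟩
  · filter_upwards [hev] with t ht
    exact ⟨(hTK _ ht.1 ht.2).1, (hTK _ ht.1 ht.2).2.1⟩
  · have h1 := τ.hasFDerivAt.comp_hasDerivAt (0 : ℝ) hTc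
    have h2 := τ.hasFDerivAt.comp_hasDerivAt (0 : ℝ) hc
    refine h1.unique (h2.congr_of_eventuallyEq ?_)
    filter_upwards [hev] with t ht
    exact (hTK _ ht.1 ht.2).2.2

/-- Differentiate `σ ∘ P ∘ Q ∘ s = id`: the derivative of `Q ∘ s` is the right inverse sought. -/
theorem IsLocalParam.surjective {K : Set J} {P : M → J} {Q : J → M} {l : M}
    (h : IsLocalParam K P Q l) {σ : J →L[ℝ] E} {s : E → J} (hs : AnalyticAt ℝ s (σ (P l)))
    (hs0 : s (σ (P l)) = P l) (hsK : ∀ᶠ z in 𝓝 (σ (P l)), s z ∈ K ∧ σ (s z) = z) :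
    ∃ R : E →L[ℝ] M, ∀ z, σ (fderiv ℝ P l (R z)) = z := by
  set z₀ := σ (P l)
  have hQ : HasFDerivAt Q (fderiv ℝ Q (P l)) (s z₀) := by
    rw [hs0]; exact h.analyticAt_inv.differentiableAt.hasFDerivAt
  have hQs := hQ.comp z₀ hs.differentiableAt.hasFDerivAt
  have hl : (Q ∘ s) z₀ = l := by simp [hs0, h.left_inv.self_of_nhds]
  have hP : HasFDerivAt P (fderiv ℝ P l) ((Q ∘ s) z₀) := by
    rw [hl]; exact h.analyticAt.differentiableAt.hasFDerivAt
  have hall := σ.hasFDerivAt.comp z₀ (hP.comp z₀ hQs)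
  have hid : HasFDerivAt (σ ∘ P ∘ Q ∘ s) (ContinuousLinearMap.id ℝ E) z₀ := by
    refine (hasFDerivAt_id z₀).congr_of_eventuallyEq ?_
    have hc : Tendsto s (𝓝 z₀) (𝓝 (P l)) := by
      simpa [ContinuousAt, hs0] using hs.continuousAt
    filter_upwards [hsK, hc.eventually h.right_inv] with z hz hz'
    simp [hz' hz.1, hz.2]
  exact ⟨(fderiv ℝ Q (P l)).comp (fderiv ℝ s z₀), fun z =>
    DFunLike.congr_fun (hall.unique hid) z⟩

/-- A curve in the fiber is pulled back by `Q`, and its velocity is killed by the derivative of `σ`.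
Conversely `R` makes `σ ∘ P` a submersion, so every kernel vector is the velocity of a curve in its
level set. -/
theorem IsLocalParam.fiberVelocities_eq [CompleteSpace E] {K : Set J} {P : M → J} {Q : J → M}
    {l : M} (h : IsLocalParam K P Q l) {σ τ : J →L[ℝ] E} (R : E →L[ℝ] M)
    (hR : ∀ z, σ (fderiv ℝ P l (R z)) = z) :
    fiberVelocities K σ τ (P l) = (((σ.comp (fderiv ℝ P l)).ker.map
      (τ.comp (fderiv ℝ P l) : M →ₗ[ℝ] E) : Submodule ℝ E) : Set E) := by
  have hPd := h.analyticAt.differentiableAt.hasFDerivAt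
  have hσP := σ.hasFDerivAt.comp l hPd
  ext w
  constructor
  · rintro ⟨c, c', hc, h0, hev, rfl⟩
    have hQ : HasFDerivAt Q (fderiv ℝ Q (P l)) (c 0) := by
      rw [h0]; exact h.analyticAt_inv.differentiableAt.hasFDerivAt
    have hQc := hQ.comp_hasDerivAt (0 : ℝ) hc
    have hP : HasFDerivAt P (fderiv ℝ P l) ((Q ∘ c) 0) := by
      simpa [h0, h.left_inv.self_of_nhds] using hPd
    have hPQc := hP.comp_hasDerivAt (0 : ℝ) hQc
    have hct : Tendsto c (𝓝 0) (𝓝 (P l)) := by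
      simpa [ContinuousAt, h0] using hc.continuousAt
    have e1 : fderiv ℝ P l (fderiv ℝ Q (P l) c') = c' := by
      refine hPQc.unique (hc.congr_of_eventuallyEq ?_)
      filter_upwards [hev, hct.eventually h.right_inv] with t ht ht'
      exact ht' ht.1
    have e2 : σ c' = 0 := by
      refine (σ.hasFDerivAt.comp_hasDerivAt (0 : ℝ) hc).unique
        ((hasDerivAt_const (0 : ℝ) (σ (P l))).congr_of_eventuallyEq ?_)
      filter_upwards [hev] with t ht
      exact ht.2
    refine ⟨fderiv ℝ Q (P l) c', ?_, ?_⟩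
    · change σ (fderiv ℝ P l (fderiv ℝ Q (P l) c')) = 0
      rw [e1, e2]
    · change τ (fderiv ℝ P l (fderiv ℝ Q (P l) c')) = τ c'
      rw [e1]
  · rintro ⟨m, hm, rfl⟩
    have hA : AnalyticAt ℝ (σ ∘ P) l := (σ.analyticAt _).comp h.analyticAt
    obtain ⟨c, hc, h0, hev⟩ := hA.exists_curve_of_fderiv_eq_zero R
      (by rw [hσP.fderiv]; exact hR) (v := m) (by rw [hσP.fderiv]; exact hm)
    have hP : HasFDerivAt P (fderiv ℝ P l) (c 0) := by rwa [h0]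
    have hct : Tendsto c (𝓝 0) (𝓝 l) := by
      simpa [ContinuousAt, h0] using hc.continuousAt
    refine ⟨P ∘ c, _, hP.comp_hasDerivAt (0 : ℝ) hc, by simp [h0], ?_, rfl⟩
    filter_upwards [hev, hct.eventually h.mem] with t ht ht'
    exact ⟨ht', ht⟩

/-- Converts the rank of `(σ, τ)`, computed in a parametrization, into a quantity intrinsic to `K`,
which the transformations of the fibers can compare. -/
theorem IsLocalParam.finrank_range [FiniteDimensional ℝ E] [FiniteDimensional ℝ M] {K : Set J}
    {P : M → J} {Q : J → M} {l : M} (h : IsLocalParam K P Q l) {σ τ : J →L[ℝ] E} (R : E →L[ℝ] M)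
    (hR : ∀ z, σ (fderiv ℝ P l (R z)) = z) :
    finrank ℝ (fderiv ℝ (fun l => (σ.prod τ) (P l)) l).range =
      finrank ℝ E + (fiberVelocities K σ τ (P l)).finrank ℝ := by
  have hd : fderiv ℝ (fun l => (σ.prod τ) (P l)) l = (σ.prod τ).comp (fderiv ℝ P l) :=
    ((σ.prod τ).hasFDerivAt.comp l h.analyticAt.differentiableAt.hasFDerivAt).fderiv
  have := FiniteDimensional.complete ℝ E
  rw [hd, h.fiberVelocities_eq R hR, Set.finrank, Submodule.span_eq]
  exact LinearMap.finrank_range_prod_of_surjective (σ.comp (fderiv ℝ P l) : M →ₗ[ℝ] E)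
    (τ.comp (fderiv ℝ P l) : M →ₗ[ℝ] E) (fun z => ⟨R z, hR z⟩)

/-- Let the analytic submanifold `K` be fibred by `σ`, let the fibers of `σ` be permuted by
transformations over `τ` which are transitive on the fibers of `τ`, and let `(σ, τ)` map `K` onto
`N × N`. Then `σ` has, near each point of `N`, an analytic section with values in a fiber of `τ`. -/
theorem exists_analytic_section_of_transitive [FiniteDimensional ℝ E] [FiniteDimensional ℝ J]
    {K : Set J} (σ τ : J →L[ℝ] E)
    (hK : ∀ v ∈ K, ∃ (L : Submodule ℝ J) (P : L → J) (Q : J → L) (l : L),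
      IsLocalParam K P Q l ∧ P l = v)
    (hs : ∀ v ∈ K, ∃ s : E → J, AnalyticAt ℝ s (σ v) ∧ s (σ v) = v ∧
      ∀ᶠ z in 𝓝 (σ v), s z ∈ K ∧ σ (s z) = z)
    (hT : ∀ v ∈ K, ∀ w ∈ K, τ v = τ w → ∃ T : J → J, DifferentiableAt ℝ T v ∧ T v = w ∧
      ∀ u ∈ K, σ u = σ v → T u ∈ K ∧ σ (T u) = σ w ∧ τ (T u) = τ u)
    {N : Set E} (hN : IsOpen N) {i : E → J} (hi : ContinuousOn i N)
    (hiK : ∀ y ∈ N, i y ∈ K ∧ τ (i y) = y)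
    (htr : ∀ a ∈ N, ∀ b ∈ N, ∃ v ∈ K, σ v = a ∧ τ v = b) {a : E} (ha : a ∈ N) :
    ∃ b ∈ N, ∃ s : E → J, AnalyticAt ℝ s a ∧ ∀ᶠ z in 𝓝 a, s z ∈ K ∧ σ (s z) = z ∧ τ (s z) = b := by
  have := FiniteDimensional.complete ℝ E
  have := FiniteDimensional.complete ℝ J
  set d : J → ℕ := fun v => (fiberVelocities K σ τ v).finrank ℝ with hd
  have hdτ : ∀ v ∈ K, ∀ w ∈ K, τ v = τ w → d v = d w := by
    intro v hv w hw h
    obtain ⟨T, h1, h2, h3⟩ := hT v hv w hw h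
    obtain ⟨T', h1', h2', h3'⟩ := hT w hw v hv h.symm
    exact congrArg (Set.finrank ℝ) ((fiberVelocities_subset h1 h2 h3).antisymm
      (fiberVelocities_subset h1' h2' h3'))
  have hrank : ∀ {L : Submodule ℝ J} {P : L → J} {Q : J → L} {l : L}, IsLocalParam K P Q l →
      finrank ℝ (fderiv ℝ (fun l => (σ.prod τ) (P l)) l).range = finrank ℝ E + d (P l) := by
    intro L P Q l h
    obtain ⟨s, s1, s2, s3⟩ := hs (P l) h.mem.self_of_nhds
    obtain ⟨R, hR⟩ := h.surjective s1 s2 s3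
    exact h.finrank_range R hR
  have hfA : ∀ {L : Submodule ℝ J} {P : L → J} {Q : J → L} {l : L}, IsLocalParam K P Q l →
      AnalyticAt ℝ (fun l => (σ.prod τ) (P l)) l := fun h =>
    ((σ.prod τ).analyticAt _).comp h.analyticAt
  -- `d` takes natural values bounded by the dimension of `E`, so a maximum exists without
  -- compactness.
  obtain ⟨y₁, hy₁, hmax⟩ : ∃ y ∈ N, ∀ z ∈ N, d (i z) ≤ d (i y) := by
    have hne : ((fun y => d (i y)) '' N).Nonempty := ⟨_, a, ha, rfl⟩
    have hb : BddAbove ((fun y => d (i y)) '' N) :=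
      ⟨finrank ℝ E, by rintro _ ⟨y, -, rfl⟩; exact Submodule.finrank_le _⟩
    obtain ⟨y, hy, hy'⟩ := Nat.sSup_mem hne hb
    exact ⟨y, hy, fun z hz => by rw [show d (i y) = _ from hy']; exact le_csSup hb ⟨z, hz, rfl⟩⟩
  -- Semicontinuity of the rank along the continuous section `i` gives one inequality, maximality at
  -- `y₁` the other.
  have hconst : ∀ᶠ y in 𝓝 y₁, y ∈ N ∧ d (i y) = d (i y₁) := by
    obtain ⟨L, P, Q, l, h, hl⟩ := hK (i y₁) (hiK y₁ hy₁).1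
    have hic : Tendsto i (𝓝 y₁) (𝓝 (P l)) := by
      rw [hl]; exact hi.continuousAt (hN.mem_nhds hy₁)
    have hQc : Tendsto Q (𝓝 (P l)) (𝓝 l) := by
      simpa [ContinuousAt, h.left_inv.self_of_nhds] using h.analyticAt_inv.continuousAt
    filter_upwards [hN.mem_nhds hy₁, hic.eventually h.right_inv,
      hic.eventually (hQc.eventually (h.eventually.and
        (hfA h).eventually_finrank_range_fderiv_le))] with y h1 h2 h3
    have h4 := h3.2
    rw [hrank h, hrank h3.1, h2 (hiK y h1).1, hl] at h4
    exact ⟨h1, le_antisymm (hmax y h1) (by omega)⟩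
  obtain ⟨N₁, hN₁, hN₁o, hy₁N⟩ := eventually_nhds_iff.1 hconst
  have hdK : ∀ v ∈ K, τ v ∈ N₁ → d v = d (i y₁) := fun v hv hvN => by
    rw [hdτ v hv (i (τ v)) (hiK _ (hN₁ _ hvN).1).1 (hiK _ (hN₁ _ hvN).1).2.symm]
    exact (hN₁ _ hvN).2
  -- Otherwise `(σ, τ)` has constant rank below `2 dim E` over `N₁`, and its image is too thin to
  -- contain `N ×ˢ N₁`.
  have hfull : finrank ℝ E ≤ d (i y₁) := by
    by_contra! hlt
    set K₁ : Set J := {v | v ∈ K ∧ τ v ∈ N₁} with hK₁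
    have hloc : ∀ v ∈ K₁, ∃ O ∈ 𝓝 v,
        dimH ((σ.prod τ) '' (K₁ ∩ O)) ≤ (finrank ℝ E + d (i y₁) : ℕ) := by
      rintro v ⟨hvK, hvN⟩
      obtain ⟨L, P, Q, l, h, rfl⟩ := hK v hvK
      have hPc : Tendsto P (𝓝 l) (𝓝 (P l)) := h.analyticAt.continuousAt
      have hQc : Tendsto Q (𝓝 (P l)) (𝓝 l) := by
        simpa [ContinuousAt, h.left_inv.self_of_nhds] using h.analyticAt_inv.continuousAt
      have hrk : ∀ᶠ l' in 𝓝 l, finrank ℝ (fderiv ℝ (fun l => (σ.prod τ) (P l)) l').range =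
          finrank ℝ E + d (i y₁) := by
        filter_upwards [h.eventually, hPc.eventually (τ.continuous.continuousAt.eventually_mem
          (hN₁o.mem_nhds hvN))] with l' h1 h2
        rw [hrank h1, hdK _ h1.mem.self_of_nhds h2]
      have hrk0 := hrk.self_of_nhds
      obtain ⟨U, hU, hdim⟩ := (hfA h).exists_dimH_image_le_of_finrank_eq
        (hrk.mono fun l' hl' => hl'.trans hrk0.symm)
      refine ⟨_, h.right_inv.and (hQc.eventually hU), ?_⟩
      rw [hrk0] at hdim
      refine le_trans (dimH_mono ?_) hdim
      rintro _ ⟨w, ⟨hw1, hw2⟩, rfl⟩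
      exact ⟨Q w, hw2.2, by simp only [hw2.1 hw1.1]⟩
    choose! O hO hOd using hloc
    -- The local bounds combine because Hausdorff dimension is countably stable and the
    -- finite-dimensional space `J` is second countable.
    obtain ⟨S, hSK, hSc, hSO⟩ := TopologicalSpace.countable_cover_nhdsWithin
      (s := K₁) (f := O) fun v hv => mem_nhdsWithin_of_mem_nhds (hO v hv)
    have h1 : dimH ((σ.prod τ) '' K₁) ≤ (finrank ℝ E + d (i y₁) : ℕ) := by
      have hsub : (σ.prod τ) '' K₁ ⊆ ⋃ v ∈ S, (σ.prod τ) '' (K₁ ∩ O v) := by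
        rintro _ ⟨w, hw, rfl⟩
        obtain ⟨v, hv, hwv⟩ := mem_iUnion₂.1 (hSO hw)
        exact mem_iUnion₂.2 ⟨v, hv, w, ⟨hw, hwv⟩, rfl⟩
      refine (dimH_mono hsub).trans ?_
      rw [dimH_bUnion hSc]
      exact iSup₂_le fun v hv => hOd v (hSK hv)
    have h2 : N ×ˢ N₁ ⊆ (σ.prod τ) '' K₁ := by
      rintro ⟨x, y⟩ ⟨hx, hy⟩
      obtain ⟨v, hv, rfl, rfl⟩ := htr x hx y (hN₁ y hy).1
      exact ⟨v, ⟨hv, hy⟩, rfl⟩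
    have h3 : dimH (N ×ˢ N₁) = finrank ℝ (E × E) :=
      Real.dimH_of_mem_nhds ((hN.prod hN₁o).mem_nhds (mk_mem_prod ha hy₁N))
    have h4 := (h3.symm.le.trans (dimH_mono h2)).trans h1
    rw [finrank_prod, Nat.cast_le] at h4
    omega
  -- Any point of `K` over `(a, y₁)` will do, since the rank is full over all of `N₁`.
  obtain ⟨v, hv, rfl, hvτ⟩ := htr a ha y₁ hy₁
  obtain ⟨L, P, Q, l, h, rfl⟩ := hK v hv
  set f : L → E × E := fun l => (σ.prod τ) (P l) with hf
  have hrk : finrank ℝ (E × E) ≤ finrank ℝ (fderiv ℝ f l).range := by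
    rw [hrank h, finrank_prod, hdK _ hv (by rwa [hvτ])]
    omega
  have htop : (fderiv ℝ f l).range = ⊤ :=
    Submodule.eq_top_of_finrank_eq (le_antisymm (Submodule.finrank_le _) hrk)
  obtain ⟨R₀, hR₀⟩ := (fderiv ℝ f l : L →ₗ[ℝ] E × E).exists_rightInverse_of_surjective htop
  obtain ⟨r, r1, r2, r3, -⟩ := (hfA h).exists_right_inverse R₀.toContinuousLinearMap
    (fun w => LinearMap.congr_fun hR₀ w)
  have hfl : f l = (σ (P l), y₁) := by rw [← hvτ]; rfl
  have hline : AnalyticAt ℝ (fun z : E => (z, y₁)) (σ (P l)) := analyticAt_id.prod analyticAt_const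
  change AnalyticAt ℝ r (f l) at r1
  change ∀ᶠ w in 𝓝 (f l), f (r w) = w at r3
  change r (f l) = l at r2
  rw [hfl] at r1 r2 r3
  have hrl : AnalyticAt ℝ (fun z => r (z, y₁)) (σ (P l)) :=
    AnalyticAt.comp (g := r) (f := fun z : E => (z, y₁)) r1 hline
  have hlt : Tendsto (fun z => r (z, y₁)) (𝓝 (σ (P l))) (𝓝 l) := by
    simpa [ContinuousAt, r2] using hrl.continuousAt
  refine ⟨y₁, hy₁, fun z => P (r (z, y₁)), ?_, ?_⟩
  · exact AnalyticAt.comp (g := P) (by rw [r2]; exact h.analyticAt) hrl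
  · have hlc : Tendsto (fun z : E => (z, y₁)) (𝓝 (σ (P l))) (𝓝 (σ (P l), y₁)) :=
      hline.continuousAt
    filter_upwards [hlt.eventually h.mem, hlc.eventually r3] with z h1 h2
    exact ⟨h1, congrArg Prod.fst h2, congrArg Prod.snd h2⟩

end Transitivity

/-! ### Analytic sections of target fibers. -/

section Sections

variable {n q : ℕ} {X : Type*} [TopologicalSpace X] [ChartedSpace (EuclideanSpace ℝ (Fin n)) X]

/-- The coordinates, with respect to the chart around `x`, of the jets in `S` whose source and
target lie in the domain of this chart. -/
def jetCoordSet (S : Set (Jet n q X)) (x : X) : Set (JetCoord n q) :=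
  {v | ∃ g ∈ S, g.src ∈ (eChart n x).source ∧ g.tgt ∈ (eChart n x).source ∧ g.coords x x = v}

theorem continuousAt_coords_one [IsManifold (𝓡 n) ω X] {x : X} {z : EuclideanSpace ℝ (Fin n)}
    (hz : z ∈ (eChart n x).target) :
    ContinuousAt (fun z => (Jet.one n q ((eChart n x).symm z)).coords x x) z := by
  have h := AnalyticAt.coords_jetAt (q := q) (k := fun z => z) (a := x) (a' := x) (b := x)
    (φ := LocalDiffeo.id n X) analyticAt_id hz (mem_univ _) ((eChart n x).map_target hz)
    ((eChart n x).map_target hz)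
  simp only [jetAt_id] at h
  exact h.continuousAt

/-- A section with values in the set of jets with given coordinates. -/
theorem exists_isAnalyticSection_of_coords [IsManifold (𝓡 n) ω X] {S : Set (Jet n q X)} {x : X}
    {b : EuclideanSpace ℝ (Fin n)} {s : EuclideanSpace ℝ (Fin n) → JetCoord n q}
    (hs : AnalyticAt ℝ s (eChart n x x))
    (hsK : ∀ᶠ z in 𝓝 (eChart n x x), s z ∈ jetCoordSet S x ∧ (s z).1 = z ∧
      tgtCoord n q (s z) = b) :
    ∃ (X₀ : X) (W : Set X) (σ : X → Jet n q X), x ∈ W ∧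
      IsAnalyticSection {g | g ∈ S ∧ g.tgt = X₀} W σ := by
  classical
  set e := eChart n x with he
  have hxe : x ∈ e.source := mem_chart_source _ x
  obtain ⟨O, hO, hOo, hxO⟩ := eventually_nhds_iff.1
    ((hs.eventually_analyticAt.and hsK).and (e.open_target.mem_nhds (e.map_source hxe)))
  -- A jet with the prescribed coordinates is chosen at each point; the unit is a default value that
  -- does not occur over the final open set.
  set σ : X → Jet n q X := fun y =>
    if h : s (e y) ∈ jetCoordSet S x then h.choose else Jet.one n q y with hσ
  have hspec : ∀ y, e y ∈ O → σ y ∈ S ∧ (σ y).src ∈ e.source ∧ (σ y).tgt ∈ e.source ∧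
      (σ y).coords x x = s (e y) := by
    intro y hy
    have h := (hO _ hy).1.2.1
    have := h.choose_spec
    simp only [hσ, dif_pos h]
    exact this
  have hsrc : ∀ y ∈ e.source, e y ∈ O → (σ y).src = y := by
    intro y hye hy
    obtain ⟨-, h1, h2, h3⟩ := hspec y hy
    have h4 := (σ y).coords_fst h1 h2
    rw [h3, (hO _ hy).1.2.2.1] at h4
    exact (e.injOn hye h1 h4).symm
  have hW : IsOpen (e.source ∩ e ⁻¹' O) := e.isOpen_inter_preimage hOo
  refine ⟨e.symm b, e.source ∩ e ⁻¹' O, σ, ⟨hxe, hxO⟩, ?_⟩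
  refine IsAnalyticSection.of_jetAnalyticAt hW (fun y hy => ⟨(hspec y hy.2).1, ?_⟩)
    (fun y hy => hsrc y hy.1 hy.2) (fun y hy => ⟨x, hy.1, x, x, ?_, ?_⟩)
  · obtain ⟨-, h1, h2, h3⟩ := hspec y hy.2
    have h4 := (σ y).tgtCoord_coords h1 h2
    rw [h3, (hO _ hy.2).1.2.2.2] at h4
    rw [h4]
    exact (e.left_inv h2).symm
  · filter_upwards [hOo.mem_nhds hy.2] with z hz
    have hez : e (e.symm z) = z := e.right_inv (hO z hz).2
    obtain ⟨-, h1, h2, -⟩ := hspec (e.symm z) (by rwa [hez])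
    exact ⟨h1, h2⟩
  · refine (hO _ hy.2).1.1.congr ?_
    filter_upwards [hOo.mem_nhds hy.2] with z hz
    have hez : e (e.symm z) = z := e.right_inv (hO z hz).2
    have := (hspec (e.symm z) (by rwa [hez])).2.2.2
    rw [hez] at this
    exact this.symm

instance JetCoord.finiteDimensional : FiniteDimensional ℝ (JetCoord n q) := by
  have (k : Fin (q + 1)) : FiniteDimensional ℝ (ContinuousMultilinearMap ℝ
      (fun _ : Fin (k : ℕ) => EuclideanSpace ℝ (Fin n)) (EuclideanSpace ℝ (Fin n))) :=
    FiniteDimensional.of_injective (V₂ := MultilinearMap ℝ _ _)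
      ContinuousMultilinearMap.toMultilinearMapLinear ContinuousMultilinearMap.toMultilinearMap_injective
  have h : FiniteDimensional ℝ ((k : Fin (q + 1)) → ContinuousMultilinearMap ℝ
      (fun _ : Fin (k : ℕ) => EuclideanSpace ℝ (Fin n)) (EuclideanSpace ℝ (Fin n))) :=
    Module.Finite.pi
  exact Module.Finite.prod

namespace LiePseudogroup

variable [IsManifold (𝓡 n) ω X]

/-- A locally transitive Lie pseudo-group has local analytic sections of target fibers. -/
theorem exists_isAnalyticSection_targetFiber (G : LiePseudogroup n q X)
    (hG : G.IsLocallyTransitive) (x : X) :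
    ∃ (X₀ : X) (W : Set X) (s : X → Jet n q X), x ∈ W ∧
      IsAnalyticSection (G.targetFiber X₀) W s := by
  set e := eChart n x with he
  have hxe : x ∈ e.source := mem_chart_source _ x
  obtain ⟨N, hN, hNo, hxN⟩ := eventually_nhds_iff.1 (hG x)
  set K := jetCoordSet G.eqns x with hKdef
  have hmul : ∀ g ∈ G.eqns, ∀ h ∈ G.eqns, ∀ H : g.src = h.tgt, h.src ∈ e.source →
      h.tgt ∈ e.source → g.tgt ∈ e.source →
      jetCompCoord (g.coords x x) (h.coords x x) ∈ K := by
    intro g hg h hh H h1 h2 h3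
    exact ⟨g.mul h H, G.mul_mem g hg h hh H, by simpa using h1, by simpa using h3,
      Jet.coords_mul H h1 h2 h3⟩
  suffices ∃ b ∈ e.target ∩ e.symm ⁻¹' N, ∃ s : EuclideanSpace ℝ (Fin n) → JetCoord n q,
      AnalyticAt ℝ s (e x) ∧ ∀ᶠ z in 𝓝 (e x), s z ∈ K ∧
        (ContinuousLinearMap.fst ℝ _ _ : JetCoord n q →L[ℝ] _) (s z) = z ∧
          tgtCoord n q (s z) = b by
    obtain ⟨b, -, s, hs, hsK⟩ := this
    exact exists_isAnalyticSection_of_coords hs hsK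
  refine exists_analytic_section_of_transitive (K := K)
    (σ := ContinuousLinearMap.fst ℝ _ _) (τ := tgtCoord n q) ?_ ?_ ?_
    (N := e.target ∩ e.symm ⁻¹' N) (e.isOpen_inter_preimage_symm hNo)
    (i := fun z => (Jet.one n q (e.symm z)).coords x x)
    (fun z hz => (continuousAt_coords_one hz.1).continuousWithinAt) ?_ ?_ (a := e x)
    ⟨e.map_source hxe, by simpa [e.left_inv hxe] using hxN⟩
  · rintro v ⟨g, hg, h1, h2, rfl⟩
    obtain ⟨Φ, L, hΦ, hΦA, hΦA', hL⟩ := G.submanifold g hg x x h1 h2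
    obtain ⟨P, Q, l, h, hl⟩ := IsLocalParam.of_chart (K := K) ⟨g, hg, h1, h2, rfl⟩ Φ L hΦ hΦA hΦA' hL
    exact ⟨L, P, Q, l, h, hl⟩
  · rintro v ⟨g, hg, h1, h2, rfl⟩
    obtain ⟨W, s, hs, hgW, hsg⟩ := G.fibred g hg
    have hgx : e.symm (e g.src) = g.src := e.left_inv h1
    obtain ⟨h3, h4⟩ := (hs.jetAnalyticAt hgW h1).coords (a := x) (b := x)
      (by simp only [← he, hgx, hsg]; exact h1) (by simp only [← he, hgx, hsg]; exact h2)
    have hfst : (g.coords x x).1 = e g.src := g.coords_fst h1 h2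
    refine ⟨fun z => (s (e.symm z)).coords x x, ?_, ?_, ?_⟩
    · simpa only [ContinuousLinearMap.coe_fst', hfst] using h4
    · simp only [ContinuousLinearMap.coe_fst', hfst, hgx, hsg]
    · simp only [ContinuousLinearMap.coe_fst', hfst]
      filter_upwards [h3, e.open_target.mem_nhds (e.map_source h1),
        (e.tendsto_symm h1).eventually (hs.isOpen.mem_nhds hgW)] with z hz hz' hzW
      refine ⟨⟨_, hs.mem _ hzW, hz.1, hz.2, rfl⟩, ?_⟩
      rw [Jet.coords_fst _ hz.1 hz.2, hs.src_eq _ hzW]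
      exact e.right_inv hz'
  · rintro v ⟨g, hg, h1, h2, rfl⟩ w ⟨h, hh, h3, h4, rfl⟩ hgh
    rw [g.tgtCoord_coords h1 h2, h.tgtCoord_coords h3 h4] at hgh
    have ht : g.tgt = h.tgt := e.injOn h2 h4 hgh
    have H1 : g.inv.src = h.tgt := g.src_inv.trans ht
    -- Right multiplication by g⁻¹h carries g to h, maps the source fiber of g into that of h, and
    -- leaves targets unchanged.
    set k := g.inv.mul h H1 with hk
    have hkG : k ∈ G.eqns := G.mul_mem _ (G.inv_mem g hg) h hh H1
    have hks : k.src = h.src := Jet.src_mul _ _ _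
    have hkt : k.tgt = g.src := (Jet.tgt_mul _ _ _).trans g.tgt_inv
    have hks' : k.src ∈ e.source := by rwa [hks]
    have hkt' : k.tgt ∈ e.source := by rwa [hkt]
    refine ⟨fun u => jetCompCoord u (k.coords x x), ?_, ?_, ?_⟩
    · exact (AnalyticAt.comp (f := fun u => (u, k.coords x x)) (jetCompCoord_analyticAt _)
        (analyticAt_id.prod analyticAt_const)).differentiableAt
    · change jetCompCoord (g.coords x x) (k.coords x x) = h.coords x x
      rw [← Jet.coords_mul (g := g) (h := k) hkt.symm hks' hkt' h2]
      have e1 : g.mul k hkt.symm = h := by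
        simp only [hk]
        rw [← Jet.mul_assoc' g g.inv h g.tgt_inv.symm H1]
        simp only [Jet.mul_inv', ht]
        exact h.one_mul'
      rw [e1]
    · rintro u ⟨f, hf, h5, h6, rfl⟩ hu
      change (f.coords x x).1 = (g.coords x x).1 at hu
      rw [f.coords_fst h5 h6, g.coords_fst h1 h2] at hu
      have hfg : f.src = g.src := e.injOn h5 h1 hu
      refine ⟨hmul f hf k hkG (hfg.trans hkt.symm) hks' hkt' h6, ?_, tgtCoord_jetCompCoord _ _⟩
      change (k.coords x x).1 = (h.coords x x).1
      rw [k.coords_fst hks' hkt', h.coords_fst h3 h4, hks]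
  · rintro y ⟨hy, -⟩
    have hy' := e.map_target hy
    refine ⟨⟨_, G.one_mem _, hy', hy', rfl⟩, ?_⟩
    rw [Jet.tgtCoord_coords _ hy' hy']
    exact e.right_inv hy
  · rintro a ⟨ha, haN⟩ b ⟨hb, hbN⟩
    obtain ⟨φ, hφ, hxφ, hφa⟩ := hN _ haN
    obtain ⟨ψ, hψ, hxψ, hψb⟩ := hN _ hbN
    set g := jet q φ x hxφ
    set h := jet q ψ x hxψ
    -- Both points are reached from `x`, so a jet from the first to the second is obtained by going
    -- back to `x` and out again.
    have H : h.src = g.inv.tgt := g.tgt_inv.symm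
    have hs : (h.mul g.inv H).src = e.symm a := by
      rw [Jet.src_mul, Jet.src_inv]; exact hφa
    have ht : (h.mul g.inv H).tgt = e.symm b := by
      rw [Jet.tgt_mul]; exact hψb
    have hs' : (h.mul g.inv H).src ∈ e.source := by rw [hs]; exact e.map_target ha
    have ht' : (h.mul g.inv H).tgt ∈ e.source := by rw [ht]; exact e.map_target hb
    refine ⟨_, ⟨h.mul g.inv H, G.mul_mem _ (hψ x hxψ) _ (G.inv_mem _ (hφ x hxφ)) H, hs', ht', rfl⟩,
      ?_, ?_⟩
    · change ((h.mul g.inv H).coords x x).1 = a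
      rw [Jet.coords_fst _ hs' ht', hs]
      exact e.right_inv ha
    · rw [Jet.tgtCoord_coords _ hs' ht', ht]
      exact e.right_inv hb

end LiePseudogroup

end Sections

/-! ### The right action and the invariance of the lifted invariants. -/

section Equivalence

variable {n q : ℕ} {X : Type*} [TopologicalSpace X] [ChartedSpace (EuclideanSpace ℝ (Fin n)) X]

theorem rightAct_eq_prod (φ : LocalDiffeo n X) (g : Jet n q X) (hg : g.src ∈ φ.source) :
    rightAct φ g hg = g.prod (jetAt q φ.symm (φ g.src)) := by
  have h : φ g.src ∈ φ.symm.source := φ.map_source hg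
  rw [jetAt_of_mem h]
  exact (Jet.prod_of_eq _).symm

variable [IsManifold (𝓡 n) ω X]

theorem rightAct_eq_mul_inv (φ : LocalDiffeo n X) (g : Jet n q X) (hg : g.src ∈ φ.source) :
    rightAct φ g hg = g.mul (jet q φ g.src hg).inv (Jet.tgt_inv (jet q φ g.src hg)).symm := by
  have h := Jet.inv_jet (q := q) hg
  simp only [h]
  rfl

theorem src_rightAct (φ : LocalDiffeo n X) (g : Jet n q X) (hg : g.src ∈ φ.source) :
    (rightAct φ g hg).src = φ g.src := Jet.src_mul _ _ _

theorem tgt_rightAct (φ : LocalDiffeo n X) (g : Jet n q X) (hg : g.src ∈ φ.source) :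
    (rightAct φ g hg).tgt = g.tgt := Jet.tgt_mul _ _ _

theorem rightAct_mul (φ : LocalDiffeo n X) (g : Jet n q X) (hg : g.src ∈ φ.source) :
    ∃ H, (rightAct φ g hg).mul (jet q φ g.src hg) H = g := by
  have H : (rightAct φ g hg).src = (jet q φ g.src hg).tgt :=
    src_rightAct φ g hg
  refine ⟨H, ?_⟩
  simp only [rightAct_eq_mul_inv]
  rw [Jet.mul_assoc' g _ _ (Jet.tgt_inv (jet q φ g.src hg)).symm (Jet.src_inv _)]
  simp only [Jet.inv_mul']
  exact g.mul_one'

theorem LiePseudogroup.rightAct_mem {G : LiePseudogroup n q X} {φ : LocalDiffeo n X}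
    (hφ : G.Mem φ) {g : Jet n q X} (hgG : g ∈ G.eqns) (hg : g.src ∈ φ.source) :
    rightAct φ g hg ∈ G.eqns := by
  rw [rightAct_eq_mul_inv]
  exact G.mul_mem _ hgG _ (G.inv_mem _ (hφ _ hg)) _

/-- The right action of a transformation carries analytic sections of a target fiber to analytic
sections of the same target fiber. -/
theorem IsAnalyticSection.rightAct_image {G : LiePseudogroup n q X} {φ : LocalDiffeo n X} (hφ : G.Mem φ)
    {X₀ : X} {W : Set X} {s : X → Jet n q X} (hs : IsAnalyticSection (G.targetFiber X₀) W s) (hW : W ⊆ φ.source) :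
    IsAnalyticSection (G.targetFiber X₀) (φ '' W)
      (fun y => (s (φ.symm y)).prod (jetAt q φ.symm y)) := by
  have hval : ∀ x ∈ W, ∃ hx : (s x).src ∈ φ.source,
      (s (φ.symm (φ x))).prod (jetAt q φ.symm (φ x)) = rightAct φ (s x) hx := by
    intro x hx
    have hsrc : (s x).src = x := hs.src_eq x hx
    have hx' : φ.symm (φ x) = x := φ.left_inv (hW hx)
    refine ⟨hsrc.symm ▸ hW hx, ?_⟩
    rw [rightAct_eq_prod, hsrc, hx']
  refine IsAnalyticSection.of_jetAnalyticAt
    (φ.toOpenPartialHomeomorph.isOpen_image_of_subset_source hs.isOpen hW) ?_ ?_ ?_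
  · rintro _ ⟨x, hx, rfl⟩
    obtain ⟨hx', e⟩ := hval x hx
    rw [e]
    refine ⟨G.rightAct_mem hφ (hs.mem x hx).1 hx', ?_⟩
    rw [tgt_rightAct]
    exact (hs.mem x hx).2
  · rintro _ ⟨x, hx, rfl⟩
    obtain ⟨hx', e⟩ := hval x hx
    rw [e, src_rightAct]
    exact congrArg φ (hs.src_eq x hx)
  · rintro _ ⟨x, hx, rfl⟩
    have hx' : φ.symm (φ x) = x := φ.left_inv (hW hx)
    set y := φ x with hy
    have hyφ : y ∈ φ.symm.source := φ.map_source (hW hx)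
    set c := eChart n y with hc
    have hyc : y ∈ c.source := mem_chart_source _ y
    have hcy : c.symm (c y) = y := c.left_inv hyc
    set a := eChart n x with ha
    have hxa : x ∈ a.source := mem_chart_source _ x
    have hcc : ContinuousAt c.symm (c y) := c.continuousAt_symm (c.map_source hyc)
    have hcφ : ContinuousAt (fun z => φ.symm (c.symm z)) (c y) :=
      ContinuousAt.comp (g := φ.symm) (f := c.symm)
        (LocalDiffeo.continuousAt φ.symm (by rwa [hcy])) hcc
    have hcφ0 : φ.symm (c.symm (c y)) = x := by rw [hcy, hx']
    refine ⟨y, hyc, JetAnalyticAt.prod ?_ ?_ ?_⟩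
    · have hk : AnalyticAt ℝ (fun z => a (φ.symm (c.symm z))) (c y) :=
        LocalDiffeo.analyticAt_charts φ.symm (c.map_source hyc)
          (show c.symm (c y) ∈ φ.symm.source by rwa [hcy])
          (show φ.symm (c.symm (c y)) ∈ a.source by rwa [hcφ0])
      refine (JetAnalyticAt.comp (γ := fun z => s (a.symm z))
        (k := fun z => a (φ.symm (c.symm z))) ?_ hk).congr ?_
      · rw [hcφ0]
        exact hs.jetAnalyticAt hx hxa
      · filter_upwards [hcφ.eventually_mem (a.open_source.mem_nhds (by rwa [hcφ0]))] with z hz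
        exact congrArg s (a.left_inv hz)
    · exact AnalyticAt.jetAnalyticAt_jetAt (k := fun z => z) analyticAt_id (c.map_source hyc)
        (show c.symm (c y) ∈ φ.symm.source by rwa [hcy])
    · filter_upwards [hcφ.eventually_mem (hs.isOpen.mem_nhds (by rwa [hcφ0])),
        hcc.eventually_mem (φ.symm.open_source.mem_nhds (by rwa [hcy]))] with z hz hz'
      rw [hs.src_eq _ hz, jetAt_of_mem hz']
      rfl

namespace HorizontalAction

variable {m : ℕ} {G : LiePseudogroup n q X} {hq : 1 ≤ q} {𝒰 : Set (EuclideanSpace ℝ (Fin m))}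

/-- The inverse jet acts as a left inverse. -/
theorem injOn (A : HorizontalAction G hq 𝒰) {g : Jet n q X} (hg : g ∈ G.eqns) :
    InjOn (A.U (g.trunc hq)) 𝒰 := by
  refine LeftInvOn.injOn (f₁' := A.U (g.inv.trunc hq)) fun u hu => ?_
  rw [← A.mul_act _ ⟨_, G.inv_mem g hg, rfl⟩ _ ⟨_, hg, rfl⟩ (by simp) u hu, ← Jet.trunc_mul hq g.inv g
    g.src_inv, g.inv_mul']
  exact A.one_act _ u hu

/-- Invariance of the lifted invariants: translating `g` on the right by the inverse jet of `φ`
cancels the motion of `u` by `φ`. -/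
theorem act_rightAct (A : HorizontalAction G hq 𝒰) {φ : LocalDiffeo n X} (hφ : G.Mem φ)
    {g : Jet n q X} (hgG : g ∈ G.eqns) (hg : g.src ∈ φ.source) {u : EuclideanSpace ℝ (Fin m)}
    (hu : u ∈ 𝒰) :
    A.U ((rightAct φ g hg).trunc hq) (A.U (jet 1 φ g.src hg) u) = A.U (g.trunc hq) u := by
  obtain ⟨H, hmul⟩ := rightAct_mul φ g hg
  conv_rhs => rw [← hmul, Jet.trunc_mul]
  exact (A.mul_act _ ⟨_, G.rightAct_mem hφ hgG hg, rfl⟩ _ ⟨_, hφ _ hg, rfl⟩ _ u hu).symm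

/-- Invariance rewrites the agreement as an equality of two values of U(s̄(φ(x)), ·), and
injectivity cancels the jet. The open set need not shrink. -/
theorem SectionsAgree.carries {A : HorizontalAction G hq 𝒰} {φ : LocalDiffeo n X} (hφ : G.Mem φ)
    {W D D' : Set X} {u u' : X → EuclideanSpace ℝ (Fin m)} (hu : MapsTo u D 𝒰)
    (hu' : MapsTo u' D' 𝒰) (h : A.SectionsAgree φ W D D' u u') : A.Carries φ W D D' u u' := by
  obtain ⟨hWD, hWD', hWφ, X₀, s, s', hs, -, hss', hU⟩ := h
  refine ⟨hWD, hWD', fun x hx => ⟨hWφ hx, ?_⟩⟩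
  have hsG := (hs.mem x hx).1
  obtain ⟨hsx, hR⟩ := hss' x hx
  have key := A.act_rightAct hφ hsG hsx (hu (hWD hx))
  rw [hU x hx, hR] at key
  have hsrc : (s x).src = x := hs.src_eq x hx
  have hjet : jet 1 φ (s x).src hsx = jet 1 φ x (hWφ hx) := by simp only [hsrc]
  rw [hjet] at key
  have hmem : s' (φ x) ∈ G.eqns := by
    rw [← hR]; exact G.rightAct_mem hφ hsG hsx
  exact A.injOn hmem (A.mapsTo _ ⟨_, hφ x (hWφ hx), rfl⟩ (hu (hWD hx))) (hu' (hWD' hx)) key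

/-- Any local section `s` of a target fiber, paired with its right translate, works by invariance.
The open set shrinks to where `s` is defined. -/
theorem Carries.exists_sectionsAgree {A : HorizontalAction G hq 𝒰} (hG : G.IsLocallyTransitive)
    {φ : LocalDiffeo n X} (hφ : G.Mem φ) {W D D' : Set X} {u u' : X → EuclideanSpace ℝ (Fin m)}
    (hu : MapsTo u D 𝒰) (hW : IsOpen W) {x₀ : X} (hx₀ : x₀ ∈ W)
    (h : A.Carries φ W D D' u u') :
    ∃ W' : Set X, IsOpen W' ∧ x₀ ∈ W' ∧ A.SectionsAgree φ W' D D' u u' := by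
  obtain ⟨X₀, W₁, s, hx₁, hs⟩ := G.exists_isAnalyticSection_targetFiber hG x₀
  have hs' : IsAnalyticSection (G.targetFiber X₀) (W ∩ W₁) s :=
    ⟨hW.inter hs.isOpen, fun x hx => hs.mem x hx.2, fun x hx => hs.src_eq x hx.2,
      fun x hx => hs.tgt_mem x hx.2, fun x hx => hs.analyticAt x hx.2⟩
  obtain ⟨hWD, hWD', hc⟩ : A.Carries φ (W ∩ W₁) D D' u u' :=
    ⟨inter_subset_left.trans h.1, h.2.1.mono_left inter_subset_left, fun x hx => h.2.2 x hx.1⟩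
  have hWφ : W ∩ W₁ ⊆ φ.source := fun x hx => (hc x hx).1
  have hR : ∀ x ∈ W ∩ W₁, ∃ hx : (s x).src ∈ φ.source, rightAct φ (s x) hx =
      (s (φ.symm (φ x))).prod (jetAt q φ.symm (φ x)) := by
    intro x hx
    have hsrc : (s x).src = x := hs'.src_eq x hx
    have hx' : φ.symm (φ x) = x := φ.left_inv (hWφ hx)
    refine ⟨hsrc.symm ▸ hWφ hx, ?_⟩
    rw [rightAct_eq_prod, hsrc, hx']
  refine ⟨W ∩ W₁, hs'.isOpen, ⟨hx₀, hx₁⟩, hWD, hWD', hWφ, X₀, s, _, hs', hs'.rightAct_image hφ hWφ,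
    hR, fun x hx => ?_⟩
  obtain ⟨hsx, e⟩ := hR x hx
  obtain ⟨hxφ, hU⟩ := hc x hx
  have hsrc : (s x).src = x := hs'.src_eq x hx
  have hjet : jet 1 φ (s x).src hsx = jet 1 φ x hxφ := by simp only [hsrc]
  change _ = A.U (((s (φ.symm (φ x))).prod (jetAt q φ.symm (φ x))).trunc hq) _
  rw [← e, ← hU, ← hjet]
  exact (A.act_rightAct hφ (hs'.mem x hx).1 hsx (hu (hWD hx))).symm

end HorizontalAction

end Equivalence
end

theorem theorem4p9 {n m q : ℕ} (hq : 1 ≤ q) {X : Type*} [TopologicalSpace X]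
    [ChartedSpace (EuclideanSpace ℝ (Fin n)) X] [IsManifold (𝓡 n) ω X]
    (G : LiePseudogroup n q X) (hG : G.IsLocallyTransitive)
    {𝒰 : Set (EuclideanSpace ℝ (Fin m))} (h𝒰 : IsOpen 𝒰) (A : HorizontalAction G hq 𝒰)
    {D D' : Set X} (hD : IsOpen D) (hD' : IsOpen D')
    {u u' : X → EuclideanSpace ℝ (Fin m)} (hu : MapsTo u D 𝒰) (hu' : MapsTo u' D' 𝒰) :
    ((∃ φ : LocalDiffeo n X, G.Mem φ ∧ ∃ W : Set X, IsOpen W ∧ W.Nonempty ∧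
        A.Carries φ W D D' u u') ↔
      (∃ ψ : LocalDiffeo n X, G.Mem ψ ∧ ∃ W : Set X, IsOpen W ∧ W.Nonempty ∧
        A.SectionsAgree ψ W D D' u u')) ∧
    ∀ φ : LocalDiffeo n X, G.Mem φ → ∀ x₀ : X,
      ((∃ W : Set X, IsOpen W ∧ x₀ ∈ W ∧ A.Carries φ W D D' u u') ↔
        (∃ W : Set X, IsOpen W ∧ x₀ ∈ W ∧ A.SectionsAgree φ W D D' u u')) := by
  refine ⟨⟨?_, ?_⟩, fun φ hφ x₀ => ⟨?_, ?_⟩⟩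
  · rintro ⟨φ, hφ, W, hW, ⟨x₀, hx₀⟩, h⟩
    obtain ⟨W', hW', hx₀', h'⟩ := h.exists_sectionsAgree hG hφ hu hW hx₀
    exact ⟨φ, hφ, W', hW', ⟨x₀, hx₀'⟩, h'⟩
  · rintro ⟨ψ, hψ, W, hW, hne, h⟩
    exact ⟨ψ, hψ, W, hW, hne, h.carries hψ hu hu'⟩
  · rintro ⟨W, hW, hx₀, h⟩
    exact h.exists_sectionsAgree hG hφ hu hW hx₀
  · rintro ⟨W, hW, hx₀, h⟩
    exact ⟨W, hW, hx₀, h.carries hφ hu hu'⟩
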